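/- **Conventions.** Manifolds are nonempty, Hausdorff, second countable, finite-dimensional (of constant dimension) and smooth; $\mathcal{M}f$ is the category of manifolds and smooth maps, $pt$ is the one-point manifold. $\Lambda$ is a finite partially ordered set. *Multifibered manifolds.* For a map $p:\{1,\dots,n\}\to\Lambda$ let $L_\alpha=\mathbb{R}^{H_\alpha}$, $H_\alpha=\{i\mid p(i)\le\alpha\}$, with the coordinate projections $L_\beta\to L_\alpha$ for $\alpha\le\beta$ and $\xi_\alpha:\mathbb{R}^n\to L_\alpha$. A multifibered manifold $\pi=(M_\alpha,\pi^\beta_\alpha,\Lambda,M)$ is a projective system over $\Lambda$ of manifolds $M_\alpha$ and surjective submersions $\pi_\alpha^\beta:M_\beta\to M_\alpha$ $(\alpha\le\beta)$, whose limit $M=\varprojlim M_\alpha$ is a manifold with surjective submersions $\pi_\alpha:M\to M_\alpha$ as projections, such that for some $n$ and $p$ there are, for every $x\in M$, charts $h$ of $M$ centered at $x$ with values in $\mathbb{R}^n$, and $h_\alpha$ of $M_\alpha$ centered at $\pi_\alpha(x)$ with values in $L_\alpha$, with $h_\alpha\circ\pi_\alpha=\xi_\alpha\circ h$ for all $\alpha$.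 A multifibered map $\pi\to\overline\pi$ is a family of smooth maps $f_\alpha:M_\alpha\to\overline M_\alpha$ which commute with the projections; it induces a smooth map $f:M\to\overline M$. These form the category $\mathcal{FM}_\Lambda$. *Bundle functors.* Let $\mathcal C$ be $\mathcal{M}f$ or $\mathcal{FM}_\Lambda$, with the base functor $B$ to $\mathcal{M}f$ that is the identity, respectively $\pi\mapsto M$. A bundle functor on $\mathcal C$ is a functor $F$ from $\mathcal C$ to fibered manifolds (surjective submersions) such that $F(X)$ is fibered over $B(X)$ and $F(f)$ covers $B(f)$, and such that for the inclusion $i:U\to X$ of an open subobject (a morphism such that $B(i)$ and, in $\mathcal{FM}_\Lambda$, all the $i_\alpha$, are diffeomorphisms onto open subsets) $F(i)$ is a diffeomorphism of $F(U)$ onto the part of $F(X)$ over $B(i)(B(U))$. Natural transformations of bundle functors are over the identities of the bases; $F$ is product preserving if its total space functor preserves finite products. *Inductive systems.* An inductive system $\mu=(\mu^\alpha_\beta:G_\alpha\to G_\beta)$ is a functor from $\Lambda$ to the category of bundle functors on $\mathcal{M}f$. Let $i_\alpha:\mathcal{M}f\to\mathcal{FM}_\Lambda$ be the functor for which $i_\alpha(X)$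 has the components $X_\gamma=X$ if $\gamma\ge\alpha$ and $X_\gamma=pt$ otherwise, with the identities of $X$ and the maps to $pt$ as projections, and let $\mathrm{id}^\alpha_\beta:i_\alpha\to i_\beta$ $(\alpha\le\beta)$ be given by the identities of the manifolds $X$. A bundle functor $F$ on $\mathcal{FM}_\Lambda$ has the associated inductive system $\mu^F$ of the transformations $F(\mathrm{id}^\alpha_\beta):G^F_\alpha\to G^F_\beta$, where $G^F_\alpha=F\circ i_\alpha$. An isomorphism of inductive systems is a family of natural equivalences commuting with the transformations $\mu^\alpha_\beta$. *The functor $T^\mu$.* Let $\mu$ be an inductive system of product preserving bundle functors $G_\alpha$. Let $$\textstyle\prod_\mu G_\alpha(\pi)=\{(x_\alpha)\in\prod_\alpha G_\alpha(M_\alpha)\mid G_\beta(\pi^\beta_\alpha)(x_\beta)=\mu^\alpha_\beta(M_\alpha)(x_\alpha)\text{ for all }\alpha\le\beta\},$$ a submanifold of the product, with the projection to $M$ induced by the bundle projections of the $G_\alpha$; $\prod_\mu G_\alpha(f)$ is the restriction of $\prod_\alpha G_\alpha(f_\alpha)$. The projection $\prod_\gamma G_\gamma(X_\gamma)\to G_\alpha(X)$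 restricts to a diffeomorphism $\mathcal O_\alpha(X):\prod_\mu G_\gamma(i_\alpha(X))\to G_\alpha(X)$. Let $T^\mu(\pi)=G_\alpha(X)$ and $I_\pi=\mathcal O_\alpha(X)^{-1}$ if $\pi=i_\alpha(X)$ for some $\alpha$ and $X$, and $T^\mu(\pi)=\prod_\mu G_\alpha(\pi)$, $I_\pi=\mathrm{id}$ otherwise (should $\alpha$ and $X$ not be unique, which can happen only for $X=pt$, choose some); the projection and the maps of $T^\mu$ are transported from $\prod_\mu G_\alpha$ by the diffeomorphisms $I_\pi:T^\mu(\pi)\to\prod_\mu G_\alpha(\pi)$. This is a bundle functor on $\mathcal{FM}_\Lambda$. *The transformation $\kappa$.* Let $F$ be a product preserving bundle functor on $\mathcal{FM}_\Lambda$. For a multifibered manifold $\pi$ let $j_\alpha:\pi\to i_\alpha(M_\alpha)$ have the components $\pi^\gamma_\alpha$ if $\gamma\ge\alpha$ and the maps to $pt$ otherwise. The maps $F(j_\alpha)$ are the components of a map $\Theta_\pi:F(\pi)\to\prod_{\mu^F}G^F_\alpha(\pi)$, and $\kappa_\pi=I_\pi^{-1}\circ\Theta_\pi:F(\pi)\to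 T^{\mu^F}(\pi)$ defines a natural transformation $\kappa:F\to T^{\mu^F}$. **Proposition 3.2.** (1) For every product preserving bundle functor $F$ on $\mathcal{FM}_\Lambda$ the natural transformation $\kappa:F\to T^{\mu^F}$ is a natural equivalence. Let $\mu=(\mu^\alpha_\beta:G_\alpha\to G_\beta)$ be an inductive system of product preserving bundle functors on $\mathcal{M}f$; then each $G_\alpha(pt)$ is a one-point manifold. (2) If all the $G_\alpha(pt)$ are the same one-point manifold, then $T^{\mu^{T^\mu}}=T^\mu$, and $\kappa$ for $F=T^\mu$ is the identity: $\kappa_\pi=\mathrm{id}_{T^\mu(\pi)}$ for every multifibered manifold $\pi$. (3) $T^\mu$ is a product preserving bundle functor, whose inductive system $\mu^{T^\mu}$ is isomorphic to $\mu$, and is equal to $\mu$ if all the $G_\alpha(pt)$ are the same one-point manifold. It is unique up to natural equivalence: every product preserving bundle functor $F$ on $\mathcal{FM}_\Lambda$ whose $\mu^F$ is equal, or only isomorphic, to $\mu$ is naturally equivalent to $T^\mu$. -/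

import Mathlib

open CategoryTheory Set Topology Opposite
open scoped ContDiff

section Manifolds

open scoped Manifold

/-- A (nonempty) smooth manifold: Hausdorff, second countable, modelled on a finite-dimensional
real normed space `E`, of class `C^∞`. -/
structure Mfd where
  carrier : Type
  E : Type
  [topE : NormedAddCommGroup E]
  [spaceE : NormedSpace ℝ E]
  [finE : FiniteDimensional ℝ E]
  [top : TopologicalSpace carrier]
  [charted : ChartedSpace E carrier]
  [manifold : IsManifold 𝓘(ℝ, E) ∞ carrier]
  [t2 : T2Space carrier]
  [sc : SecondCountableTopology carrier]
  [ne : Nonempty carrier]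

namespace Mfd

instance : CoeSort Mfd Type := ⟨Mfd.carrier⟩

attribute [instance] Mfd.topE Mfd.spaceE Mfd.finE Mfd.top Mfd.charted Mfd.manifold Mfd.t2
  Mfd.sc Mfd.ne

/-- Smooth maps. -/
@[ext]
structure Hom (M N : Mfd) where
  toFun : M → N
  smooth : ContMDiff 𝓘(ℝ, M.E) 𝓘(ℝ, N.E) ∞ toFun

/-- The category `Mf` of smooth manifolds and smooth maps. -/
instance : Category Mfd where
  Hom := Hom
  id M := ⟨id, contMDiff_id⟩
  comp f g := ⟨g.toFun ∘ f.toFun, g.smooth.comp f.smooth⟩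

@[ext] theorem hom_ext {M N : Mfd} {f g : M ⟶ N} (h : ∀ x, f.toFun x = g.toFun x) : f = g :=
  Hom.ext (funext h)

@[simp] theorem id_toFun (M : Mfd) (x : M) : Hom.toFun (𝟙 M) x = x := rfl

@[simp] theorem comp_toFun {M N K : Mfd} (f : M ⟶ N) (g : N ⟶ K) (x : M) :
    Hom.toFun (f ≫ g) x = g.toFun (f.toFun x) := rfl

theorem congr_toFun {M N : Mfd} {f g : M ⟶ N} (h : f = g) (x : M) : f.toFun x = g.toFun x := by
  rw [h]

/-- A smooth map which is a diffeomorphism onto an open subset. -/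
def IsOpenEmb {M N : Mfd} (f : M ⟶ N) : Prop :=
  IsOpen (range f.toFun) ∧ ∃ g : N → M, Function.LeftInverse g f.toFun ∧
    ContMDiffOn 𝓘(ℝ, N.E) 𝓘(ℝ, M.E) ∞ g (range f.toFun)

/-- A submersion: the tangent map is surjective at every point. -/
def IsSubmersion {M N : Mfd} (f : M ⟶ N) : Prop :=
  ∀ x, Function.Surjective (mfderiv 𝓘(ℝ, M.E) 𝓘(ℝ, N.E) f.toFun x)

theorem IsOpenEmb.injective {M N : Mfd} {f : M ⟶ N} (h : IsOpenEmb f) :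
    Function.Injective f.toFun := by
  obtain ⟨_, g, hg, _⟩ := h
  exact hg.injective

theorem iso_hom_inv {M N : Mfd} (e : M ≅ N) (x : M) : e.inv.toFun (e.hom.toFun x) = x :=
  congr_toFun e.hom_inv_id x

theorem iso_inv_hom {M N : Mfd} (e : M ≅ N) (x : N) : e.hom.toFun (e.inv.toFun x) = x :=
  congr_toFun e.inv_hom_id x

theorem iso_surjective {M N : Mfd} (e : M ≅ N) : Function.Surjective e.hom.toFun :=
  fun y => ⟨_, iso_inv_hom e y⟩

theorem iso_range {M N : Mfd} (e : M ≅ N) : range e.hom.toFun = univ :=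
  (iso_surjective e).range_eq

theorem isOpenEmb_iso {M N : Mfd} (e : M ≅ N) : IsOpenEmb e.hom := by
  refine ⟨by rw [iso_range]; exact isOpen_univ, e.inv.toFun, iso_hom_inv e, e.inv.smooth.contMDiffOn⟩

theorem IsOpenEmb.comp {M N K : Mfd} {f : M ⟶ N} {g : N ⟶ K} (hf : IsOpenEmb f)
    (hg : IsOpenEmb g) : IsOpenEmb (f ≫ g) := by
  obtain ⟨of, f', hf', sf⟩ := hf
  obtain ⟨og, g', hg', sg⟩ := hg
  have hr : range (Hom.toFun (f ≫ g)) = range g.toFun ∩ g' ⁻¹' (range f.toFun) := by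
    ext z
    constructor
    · rintro ⟨x, rfl⟩
      exact ⟨⟨_, rfl⟩, ⟨x, (hg' _).symm⟩⟩
    · rintro ⟨⟨y, rfl⟩, ⟨x, hx⟩⟩
      rw [hg' y] at hx
      exact ⟨x, by simp [hx]⟩
  refine ⟨?_, f' ∘ g', fun x => by simp [hg' _, hf' _], ?_⟩
  · rw [hr]
    exact sg.continuousOn.isOpen_inter_preimage og of
  · refine sf.comp (sg.mono ?_) ?_
    · rw [hr]; exact inter_subset_left
    · rw [hr]; exact inter_subset_right

theorem mdiff {M N : Mfd} (f : M ⟶ N) (x : M) :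
    MDifferentiableAt 𝓘(ℝ, M.E) 𝓘(ℝ, N.E) f.toFun x :=
  (f.smooth x).mdifferentiableAt (by simp)

theorem IsSubmersion.comp {M N K : Mfd} {f : M ⟶ N} {g : N ⟶ K} (hf : IsSubmersion f)
    (hg : IsSubmersion g) : IsSubmersion (f ≫ g) := by
  intro x
  have := mfderiv_comp x (mdiff g (f.toFun x)) (mdiff f x)
  change Function.Surjective (mfderiv _ _ (g.toFun ∘ f.toFun) x)
  rw [this]
  exact (hg (f.toFun x)).comp (hf x)

/-- If a composite is a submersion at `x` then the second map is one at the image of `x`. -/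
theorem surjective_of_comp {M N K : Mfd} (f : M ⟶ N) (g : N ⟶ K) (x : M)
    (h : Function.Surjective (mfderiv 𝓘(ℝ, M.E) 𝓘(ℝ, K.E) (Hom.toFun (f ≫ g)) x)) :
    Function.Surjective (mfderiv 𝓘(ℝ, N.E) 𝓘(ℝ, K.E) g.toFun (f.toFun x)) := by
  have := mfderiv_comp x (mdiff g (f.toFun x)) (mdiff f x)
  change Function.Surjective (mfderiv _ _ (g.toFun ∘ f.toFun) x) at h
  rw [this] at h
  exact Function.Surjective.of_comp h

theorem IsOpenEmb.isSubmersion {M N : Mfd} {f : M ⟶ N} (h : IsOpenEmb f) : IsSubmersion f := by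
  obtain ⟨o, g, hg, sg⟩ := h
  intro x
  have hx : range f.toFun ∈ 𝓝 (f.toFun x) := o.mem_nhds ⟨x, rfl⟩
  have dg := (sg.contMDiffAt hx).mdifferentiableAt (n := ∞) (by simp)
  have df : MDifferentiableAt 𝓘(ℝ, M.E) 𝓘(ℝ, N.E) f.toFun (g (f.toFun x)) := mdiff f _
  have h1 := mfderiv_comp (f.toFun x) df dg
  have h2 : (f.toFun ∘ g) =ᶠ[𝓝 (f.toFun x)] id := by
    filter_upwards [hx] with y hy
    obtain ⟨z, rfl⟩ := hy
    simp [hg z]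
  rw [h2.mfderiv_eq, mfderiv_id, hg x] at h1
  intro v
  exact ⟨_, (DFunLike.congr_fun h1 v).symm⟩

theorem isSubmersion_iso {M N : Mfd} (e : M ≅ N) : IsSubmersion e.hom :=
  (isOpenEmb_iso e).isSubmersion

/-! ### Euclidean spaces and the one-point manifold -/

/-- The manifold `ℝ^ι`. -/
noncomputable def euc (ι : Type) [Finite ι] : Mfd :=
  letI := Fintype.ofFinite ι
  { carrier := ι → ℝ
    E := ι → ℝ }

/-- The real line. -/
noncomputable def line : Mfd := { carrier := ℝ, E := ℝ }

/-- The one-point manifold. -/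
noncomputable def pt : Mfd := { carrier := PUnit, E := PUnit }

/-- The linear map `ℝ^ι → ℝ^κ` induced by a map of index sets; it selects coordinates. -/
noncomputable def eucMap {ι κ : Type} [Finite ι] [Finite κ] (f : κ → ι) : euc ι ⟶ euc κ :=
  ⟨fun x k => x (f k), by
    let := Fintype.ofFinite ι
    let := Fintype.ofFinite κ
    exact contMDiff_pi_space.2 fun k => (contDiff_apply ℝ ℝ (f k)).contMDiff⟩

/-- The `i`-th coordinate function. -/
noncomputable def coord {ι : Type} [Finite ι] (i : ι) : euc ι ⟶ line :=
  ⟨fun x => x i, by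
    let := Fintype.ofFinite ι
    exact (contDiff_apply ℝ ℝ i).contMDiff⟩

/-- A map into `ℝ^ι` with given coordinates. -/
noncomputable def eucLift {ι : Type} [Finite ι] {Y : Mfd} (f : ι → (Y ⟶ line)) : Y ⟶ euc ι :=
  ⟨fun y i => (f i).toFun y, by
    let := Fintype.ofFinite ι
    exact contMDiff_pi_space.2 fun i => (f i).smooth⟩

/-- The unique map to the one-point manifold. -/
noncomputable def toPt (M : Mfd) : M ⟶ pt := ⟨fun _ => PUnit.unit, contMDiff_const⟩

theorem hom_pt_ext {M : Mfd} (f g : M ⟶ pt) : f = g := by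
  ext x; rfl

/-- The one-point manifold is terminal. -/
noncomputable def ptIsTerminal : Limits.IsTerminal pt :=
  Limits.IsTerminal.ofUniqueHom toPt fun _ _ => hom_pt_ext _ _

/-- The constant map. -/
noncomputable def constHom (M : Mfd) {N : Mfd} (y : N) : M ⟶ N := ⟨fun _ => y, contMDiff_const⟩

/-- A terminal manifold has at most one point. -/
theorem subsingleton_of_isTerminal {M : Mfd} (h : Limits.IsTerminal M) (x y : M) : x = y :=
  congr_toFun (h.hom_ext (constHom pt x) (constHom pt y)) PUnit.unit

/-! ### Finite products -/

/-- The product of a finite family of manifolds. -/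
noncomputable def pi {ι : Type} [Finite ι] (M : ι → Mfd) : Mfd :=
  letI := Fintype.ofFinite ι
  letI cs : ChartedSpace (∀ i, (M i).E) (∀ i, M i) :=
    piChartedSpace (fun i => (M i).E) (fun i => (M i).carrier)
  haveI : IsManifold 𝓘(ℝ, ∀ i, (M i).E) ∞ (∀ i, M i) := by
    apply isManifold_of_contDiffOn
    rintro _ _ ⟨e, he, rfl⟩ ⟨e', he', rfl⟩
    rw [contDiffOn_pi]
    intro i
    have h := (contDiffGroupoid ∞ 𝓘(ℝ, (M i).E)).compatible (he i (mem_univ i)) (he' i (mem_univ i))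
    have h := ((contDiffGroupoid ∞ 𝓘(ℝ, (M i).E)).mem_iff_of_eqOnSource (by rfl)).1 h
    rw [contDiffGroupoid, mem_groupoid_of_pregroupoid] at h
    have h1 : ContDiffOn ℝ ∞ ((e i).symm.trans (e' i)) ((e i).symm.trans (e' i)).source := by
      simpa [contDiffPregroupoid] using h.1
    refine h1.comp (ContinuousLinearMap.proj (R := ℝ) (φ := fun i => (M i).E) i).contDiff.contDiffOn ?_
    intro x hx
    simp at hx ⊢
    exact hx i
  { carrier := ∀ i, M i
    E := ∀ i, (M i).E }

theorem pi_smooth_iff {ι : Type} [Finite ι] {M : ι → Mfd} {Y : Mfd} (f : Y → pi M) (s : Set Y)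
    (h : ∀ i, ContMDiffOn 𝓘(ℝ, Y.E) 𝓘(ℝ, (M i).E) ∞ (fun y => f y i) s) :
    ContMDiffOn 𝓘(ℝ, Y.E) 𝓘(ℝ, (pi M).E) ∞ f s := by
  let := Fintype.ofFinite ι
  intro y hy
  have hc : ContinuousWithinAt f s y :=
    continuousWithinAt_pi.2 fun i => (h i y hy).continuousWithinAt
  refine contMDiffWithinAt_iff_target.2 ⟨hc, ?_⟩
  refine contMDiffWithinAt_pi_space.2 fun i => ?_
  exact (contMDiffWithinAt_iff_target.1 (h i y hy)).2

/-- The projections of a finite product. -/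
noncomputable def piProj {ι : Type} [Finite ι] (M : ι → Mfd) (i : ι) : pi M ⟶ M i :=
  ⟨fun x => x i, by
    let := Fintype.ofFinite ι
    intro x
    refine contMDiffAt_iff.2 ⟨(continuous_apply i).continuousAt, ?_⟩
    have h0 : ContDiffWithinAt ℝ ∞ (fun z : ∀ i, (M i).E => z i) univ
        (extChartAt 𝓘(ℝ, (pi M).E) x x) :=
      (ContinuousLinearMap.proj (R := ℝ) (φ := fun i => (M i).E) i).contDiff.contDiffWithinAt
    have h1 : range 𝓘(ℝ, (pi M).E) = univ := by simp
    rw [h1]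
    refine h0.congr_of_eventuallyEq_of_mem ?_ (mem_univ _)
    refine Filter.Eventually.filter_mono nhdsWithin_le_nhds ?_
    have h2 := extChartAt_target_mem_nhds (I := 𝓘(ℝ, (pi M).E)) x
    filter_upwards [h2] with z hz
    have hz' : z i ∈ (chartAt (M i).E (x i)).target := by
      have h3 : z ∈ (chartAt (pi M).E x).target := by
        rw [extChartAt_target] at hz; exact hz.1
      exact h3 i (mem_univ i)
    have := (chartAt (M i).E (x i)).right_inv hz'
    exact this⟩

/-- A map into a finite product with given components. -/
noncomputable def piLift {ι : Type} [Finite ι] {M : ι → Mfd} {Y : Mfd} (f : ∀ i, Y ⟶ M i) :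
    Y ⟶ pi M :=
  ⟨fun y i => (f i).toFun y, contMDiffOn_univ.1
    (pi_smooth_iff _ _ fun i => (f i).smooth.contMDiffOn)⟩

theorem pi_ext {ι : Type} [Finite ι] {M : ι → Mfd} {x y : pi M} (h : ∀ i, x i = y i) : x = y :=
  funext h

theorem coord_mfderiv {ι : Type} [Finite ι] {Y : Mfd} (F : Y ⟶ euc ι) (y : Y) (i : ι) (w : Y.E) :
    mfderiv 𝓘(ℝ, Y.E) 𝓘(ℝ, line.E) (Hom.toFun (F ≫ coord i)) y w =
      (mfderiv 𝓘(ℝ, Y.E) 𝓘(ℝ, (euc ι).E) F.toFun y w : ι → ℝ) i := by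
  let := Fintype.ofFinite ι
  have h := mfderiv_comp y (mdiff (coord i) (F.toFun y)) (mdiff F y)
  have h1 : mfderiv 𝓘(ℝ, (euc ι).E) 𝓘(ℝ, line.E) (coord i).toFun (F.toFun y) =
      ContinuousLinearMap.proj (R := ℝ) (φ := fun _ : ι => ℝ) i :=
    mfderiv_eq_fderiv.trans (ContinuousLinearMap.proj (R := ℝ) (φ := fun _ : ι => ℝ) i).fderiv
  rw [h1] at h
  exact DFunLike.congr_fun h w

open Classical in
/-- The embedding of a factor of a finite product as a slice through a given point. -/
noncomputable def slice {ι : Type} [Finite ι] {M : ι → Mfd} (x : pi M) (i : ι) : M i ⟶ pi M :=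
  piLift fun j => if h : i = j then eqToHom (congrArg M h) else constHom (M i) (x j)

open Classical in
theorem slice_self {ι : Type} [Finite ι] {M : ι → Mfd} (x : pi M) (i : ι) :
    slice x i ≫ piProj M i = 𝟙 (M i) := by
  ext z
  change Hom.toFun (dite _ _ _) z = z
  rw [dif_pos rfl]
  rfl

open Classical in
theorem slice_ne {ι : Type} [Finite ι] {M : ι → Mfd} (x : pi M) {i j : ι} (h : i ≠ j) :
    slice x i ≫ piProj M j = constHom (M i) (x j) := by
  ext z
  change Hom.toFun (dite _ _ _) z = _
  rw [dif_neg h]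

theorem slice_apply {ι : Type} [Finite ι] {M : ι → Mfd} (x : pi M) (i : ι) :
    (slice x i).toFun (x i) = x := by
  refine pi_ext fun j => ?_
  by_cases h : i = j
  · subst h
    exact congr_toFun (slice_self x i) (x i)
  · exact congr_toFun (slice_ne x h) (x i)

/-- A product of real-valued submersions is a submersion. -/
theorem isSubmersion_eucLift {ι : Type} [Finite ι] {M : ι → Mfd} (f : ∀ i, M i ⟶ line)
    (hf : ∀ i, IsSubmersion (f i)) : IsSubmersion (eucLift fun i => piProj M i ≫ f i) := by
  classical
  intro x
  let := Fintype.ofFinite ι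
  let F : pi M ⟶ euc ι := eucLift fun i => piProj M i ≫ f i
  let D : (pi M).E →L[ℝ] (ι → ℝ) := mfderiv 𝓘(ℝ, (pi M).E) 𝓘(ℝ, (euc ι).E) F.toFun x
  have key : ∀ (i : ι) (c : ℝ), ∃ v, D v = Pi.single i c := fun i c => by
    obtain ⟨w, hw⟩ := hf i (x i) c
    let D' : (M i).E →L[ℝ] (pi M).E :=
      mfderiv 𝓘(ℝ, (M i).E) 𝓘(ℝ, (pi M).E) (slice x i).toFun (x i)
    refine ⟨D' w, ?_⟩
    have hc : D (D' w) = (mfderiv 𝓘(ℝ, (M i).E) 𝓘(ℝ, (euc ι).E)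
        (Hom.toFun (slice x i ≫ F)) (x i) w : ι → ℝ) := by
      have h := mfderiv_comp (x i) (mdiff F ((slice x i).toFun (x i))) (mdiff (slice x i) (x i))
      rw [slice_apply] at h
      exact (DFunLike.congr_fun h w).symm
    refine hc.trans (funext fun j => ?_)
    refine (coord_mfderiv (slice x i ≫ F) (x i) j w).symm.trans ?_
    by_cases h : i = j
    · subst h
      have h1 : (slice x i ≫ F) ≫ coord i = f i := by
        change (slice x i ≫ piProj M i) ≫ f i = f i
        rw [slice_self, Category.id_comp]
      rw [h1, Pi.single_eq_same]
      exact hw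
    · have h1 : (slice x i ≫ F) ≫ coord j = constHom (M i) ((f j).toFun (x j)) := by
        change (slice x i ≫ piProj M j) ≫ f j = _
        rw [slice_ne x h]
        rfl
      rw [h1, Pi.single_eq_of_ne' h]
      have h2 : mfderiv 𝓘(ℝ, (M i).E) 𝓘(ℝ, line.E)
        (constHom (M i) ((f j).toFun (x j))).toFun (x i) = 0 := mfderiv_const
      rw [h2]
      rfl
  intro v
  choose w hw using fun i => key i ((v : ι → ℝ) i)
  refine ⟨∑ i, w i, ?_⟩
  change D (∑ i, w i) = v
  rw [map_sum]
  simp only [hw]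
  exact Finset.univ_sum_single (v : ι → ℝ)

/-! ### Submanifolds -/

/-- `S` is an embedded submanifold of `P`: near each of its points it is parametrized by an
injective smooth map from a fixed manifold `N` which has a smooth left inverse defined on an open
subset of `P`. -/
def IsSubmfd (P : Mfd) (S : Set P) : Prop :=
  S.Nonempty ∧ ∃ N : Mfd, ∀ s ∈ S, ∃ (Ψ : N ⟶ P) (W : Set P) (ρ : P → N),
    IsOpen W ∧ s ∈ W ∧ ContMDiffOn 𝓘(ℝ, P.E) 𝓘(ℝ, N.E) ∞ ρ W ∧
    Function.LeftInverse ρ Ψ.toFun ∧ range Ψ.toFun = S ∩ W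

namespace IsSubmfd

variable {P : Mfd} {S : Set P} (h : IsSubmfd P S)

/-- The parametrizing manifold. -/
noncomputable def N : Mfd := h.2.choose

theorem exists_param (s : S) : ∃ (Ψ : h.N ⟶ P) (W : Set P) (ρ : P → h.N),
    IsOpen W ∧ (s : P) ∈ W ∧ ContMDiffOn 𝓘(ℝ, P.E) 𝓘(ℝ, h.N.E) ∞ ρ W ∧
    Function.LeftInverse ρ Ψ.toFun ∧ range Ψ.toFun = S ∩ W :=
  h.2.choose_spec s s.2

noncomputable def Ψ (s : S) : h.N ⟶ P := (h.exists_param s).choose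
noncomputable def W (s : S) : Set P := (h.exists_param s).choose_spec.choose
noncomputable def ρ (s : S) : P → h.N := (h.exists_param s).choose_spec.choose_spec.choose

theorem spec (s : S) : IsOpen (h.W s) ∧ (s : P) ∈ h.W s ∧
    ContMDiffOn 𝓘(ℝ, P.E) 𝓘(ℝ, h.N.E) ∞ (h.ρ s) (h.W s) ∧
    Function.LeftInverse (h.ρ s) (h.Ψ s).toFun ∧ range (h.Ψ s).toFun = S ∩ h.W s :=
  (h.exists_param s).choose_spec.choose_spec.choose_spec

theorem Ψ_mem (s : S) (y : h.N) : (h.Ψ s).toFun y ∈ S ∩ h.W s := by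
  rw [← (h.spec s).2.2.2.2]; exact ⟨y, rfl⟩

theorem Ψ_ρ (s : S) {x : P} (hx : x ∈ S) (hW : x ∈ h.W s) : (h.Ψ s).toFun (h.ρ s x) = x := by
  have : x ∈ range (h.Ψ s).toFun := by rw [(h.spec s).2.2.2.2]; exact ⟨hx, hW⟩
  obtain ⟨y, rfl⟩ := this
  rw [(h.spec s).2.2.2.1 y]

/-- The inverse of a parametrization, as a partial homeomorphism from `S` (with the subspace
topology) to `N`. -/
noncomputable def homeo (s : S) : OpenPartialHomeomorph S h.N where
  toFun x := h.ρ s x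
  invFun y := ⟨(h.Ψ s).toFun y, (h.Ψ_mem s y).1⟩
  source := {x : S | (x : P) ∈ h.W s}
  target := univ
  map_source' _ _ := mem_univ _
  map_target' y _ := (h.Ψ_mem s y).2
  left_inv' x hx := Subtype.ext (h.Ψ_ρ s x.2 hx)
  right_inv' y _ := (h.spec s).2.2.2.1 y
  open_source := (h.spec s).1.preimage continuous_subtype_val
  open_target := isOpen_univ
  continuousOn_toFun := (h.spec s).2.2.1.continuousOn.comp continuous_subtype_val.continuousOn
    fun _ hx => hx
  continuousOn_invFun := ((h.Ψ s).smooth.continuous.subtype_mk _).continuousOn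

/-- The charts of a submanifold: charts of `N` transported by the parametrizations. -/
noncomputable def chart (s : S) (e : OpenPartialHomeomorph h.N h.N.E) :
    OpenPartialHomeomorph S h.N.E := (h.homeo s).trans e

/-- The charted space structure of a submanifold. -/
@[reducible] noncomputable def chartedSpace : ChartedSpace h.N.E S where
  atlas := {φ | ∃ s, ∃ e ∈ atlas h.N.E h.N, φ = h.chart s e}
  chartAt s := h.chart s (chartAt h.N.E (h.ρ s s))
  mem_chart_source s := by
    simp only [chart, OpenPartialHomeomorph.trans_source]
    exact ⟨(h.spec s).2.1, mem_chart_source _ _⟩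
  chart_mem_atlas s := ⟨s, _, chart_mem_atlas _ _, rfl⟩

theorem isManifold : @IsManifold ℝ _ h.N.E _ _ h.N.E _ 𝓘(ℝ, h.N.E) ∞ S _ h.chartedSpace := by
  let := h.chartedSpace
  apply isManifold_of_contDiffOn
  rintro _ _ ⟨s, e, he, rfl⟩ ⟨s', e', he', rfl⟩
  have hM := IsManifold.subset_maximalAtlas (I := 𝓘(ℝ, h.N.E)) (n := ∞) he
  have hM' := IsManifold.subset_maximalAtlas (I := 𝓘(ℝ, h.N.E)) (n := ∞) he'
  intro x hx
  have hx1 : (x ∈ e.target ∧ True) ∧ (h.Ψ s).toFun (e.symm x) ∈ h.W s' ∧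
      h.ρ s' ((h.Ψ s).toFun (e.symm x)) ∈ e'.source := by
    simpa [chart, homeo] using hx
  obtain ⟨⟨hx1, -⟩, hx2, hx3⟩ := hx1
  have h1 : ContMDiffAt 𝓘(ℝ, h.N.E) 𝓘(ℝ, h.N.E) ∞ e.symm x :=
    contMDiffAt_symm_of_mem_maximalAtlas hM hx1
  have h2 : ContMDiffAt 𝓘(ℝ, h.N.E) 𝓘(ℝ, h.N.E) ∞ e' (h.ρ s' ((h.Ψ s).toFun (e.symm x))) :=
    contMDiffAt_of_mem_maximalAtlas hM' hx3
  have h3 := (h.spec s').2.2.1.contMDiffAt ((h.spec s').1.mem_nhds hx2)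
  have h4 := h2.comp x (h3.comp x (((h.Ψ s).smooth (e.symm x)).comp x h1))
  exact h4.contDiffAt.contDiffWithinAt

/-- A submanifold as a manifold. -/
noncomputable def mfd : Mfd :=
  letI := h.chartedSpace
  haveI := h.isManifold
  haveI : Nonempty S := h.1.to_subtype
  { carrier := S
    E := h.N.E }

/-- The points of a submanifold. -/
def toSub (x : h.mfd) : S := x

theorem smoothOn_of_comp {Z : Mfd} (f : Z → h.mfd) (A : Set Z)
    (hf : ContMDiffOn 𝓘(ℝ, Z.E) 𝓘(ℝ, P.E) ∞ (fun z => (h.toSub (f z) : P)) A) :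
    ContMDiffOn 𝓘(ℝ, Z.E) 𝓘(ℝ, h.mfd.E) ∞ f A := by
  intro z hz
  have hc : ContinuousWithinAt f A z :=
    (Topology.IsInducing.subtypeVal.continuousWithinAt_iff).2 (hf z hz).continuousWithinAt
  refine contMDiffWithinAt_iff_target.2 ⟨hc, ?_⟩
  have h3 := (h.spec (h.toSub (f z))).2.2.1.contMDiffAt
    ((h.spec (h.toSub (f z))).1.mem_nhds (h.spec (h.toSub (f z))).2.1)
  have h2 := (contMDiffAt_extChartAt (I := 𝓘(ℝ, h.N.E)) (n := ∞)
    (x := h.ρ (h.toSub (f z)) (h.toSub (f z))))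
  have h5 := ContMDiffAt.comp_contMDiffWithinAt (g := h.ρ (h.toSub (f z)))
    (f := fun z => (h.toSub (f z) : P)) z h3 (hf z hz)
  have h6 := ContMDiffAt.comp_contMDiffWithinAt (g := extChartAt 𝓘(ℝ, h.N.E)
    (h.ρ (h.toSub (f z)) (h.toSub (f z)))) z h2 h5
  exact h6

/-- The inclusion of a submanifold. -/
noncomputable def incl : h.mfd ⟶ P where
  toFun x := h.toSub x
  smooth := by
    intro t
    have h1 : ContMDiffAt 𝓘(ℝ, h.mfd.E) 𝓘(ℝ, h.mfd.E) ∞ (extChartAt 𝓘(ℝ, h.mfd.E) t) t :=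
      contMDiffAt_extChartAt (I := 𝓘(ℝ, h.mfd.E)) (n := ∞) (x := t)
    have h2 : ContMDiffAt 𝓘(ℝ, h.mfd.E) 𝓘(ℝ, h.N.E) ∞
        (fun v : h.mfd.E => (chartAt h.N.E (h.ρ (h.toSub t) (h.toSub t))).symm v)
        (extChartAt 𝓘(ℝ, h.mfd.E) t t) := by
      refine contMDiffAt_symm_of_mem_maximalAtlas (I := 𝓘(ℝ, h.N.E))
        (IsManifold.subset_maximalAtlas (chart_mem_atlas _ _)) ?_
      exact (chartAt h.N.E (h.ρ (h.toSub t) (h.toSub t))).map_source (mem_chart_source _ _)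
    have h4 := ((h.Ψ (h.toSub t)).smooth _).comp t (h2.comp t h1)
    refine h4.congr_of_eventuallyEq ?_
    have h5 : (chartAt h.mfd.E t).source ∈ 𝓝 t := chart_source_mem_nhds _ _
    filter_upwards [h5] with x hx
    have hx' : h.toSub x ∈ (h.chart (h.toSub t)
      (chartAt h.N.E (h.ρ (h.toSub t) (h.toSub t)))).source := hx
    simp only [chart, OpenPartialHomeomorph.trans_source] at hx'
    have h6 : (chartAt h.N.E (h.ρ (h.toSub t) (h.toSub t))).symm
        (extChartAt 𝓘(ℝ, h.mfd.E) t x) = h.ρ (h.toSub t) (h.toSub x) :=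
      (chartAt h.N.E (h.ρ (h.toSub t) (h.toSub t))).left_inv hx'.2
    simp only [Function.comp_apply]
    rw [h6]
    exact (h.Ψ_ρ (h.toSub t) (h.toSub x).2 hx'.1).symm

theorem incl_injective : Function.Injective h.incl.toFun := Subtype.val_injective

/-- Maps into a submanifold. -/
noncomputable def lift {Z : Mfd} (f : Z ⟶ P) (hf : ∀ z, f.toFun z ∈ S) : Z ⟶ h.mfd :=
  ⟨fun z => (⟨f.toFun z, hf z⟩ : S), contMDiffOn_univ.1
    (IsSubmfd.smoothOn_of_comp h _ _ f.smooth.contMDiffOn)⟩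

@[simp] theorem incl_lift {Z : Mfd} (f : Z ⟶ P) (hf : ∀ z, f.toFun z ∈ S) (z : Z) :
    h.incl.toFun ((h.lift f hf).toFun z) = f.toFun z := rfl

theorem incl_mem (x : h.mfd) : h.incl.toFun x ∈ S := (h.toSub x).2

end IsSubmfd
end Mfd

end Manifolds

/-! ### Bundle functors -/

/-- A bundle functor `F : C ⥤ FM` on a category `C` over manifolds with base functor
`m : C ⥤ Mf` and with a class `opn` of inclusions of open subobjects.  A functor to fibered
manifolds whose base functor is `m` is the same as a functor `tot` of total spaces together with
a natural projection `proj : tot ⟶ m` by surjective submersions.  The last two fields are the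
localization condition: over an open subobject `i : U → X`, the value `F(U)` is identified by `F(i)`
with the restriction of `F(X)` to the open set `m(U)`. -/
structure BunFun {C : Type 1} [Category.{0} C] (m : C ⥤ Mfd) (opn : MorphismProperty C) where
  tot : C ⥤ Mfd
  proj : tot ⟶ m
  surj : ∀ X, Function.Surjective (proj.app X).toFun
  subm : ∀ X, Mfd.IsSubmersion (proj.app X)
  loc : ∀ {X Y : C} (i : X ⟶ Y), opn i → Mfd.IsOpenEmb (tot.map i)
  loc_range : ∀ {X Y : C} (i : X ⟶ Y), opn i →
    range (tot.map i).toFun = (proj.app Y).toFun ⁻¹' range (m.map i).toFun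

namespace BunFun

variable {C : Type 1} [Category.{0} C] {m : C ⥤ Mfd} {opn : MorphismProperty C}

/-- Natural transformations of bundle functors, consisting of maps of fibered manifolds over the
identities of the bases. -/
@[ext]
structure Hom (F G : BunFun m opn) where
  nat : F.tot ⟶ G.tot
  base : nat ≫ G.proj = F.proj

instance : Category.{1} (BunFun m opn) where
  Hom := Hom
  id F := ⟨𝟙 _, by simp⟩
  comp f g := ⟨f.nat ≫ g.nat, by rw [Category.assoc, g.base, f.base]⟩

@[ext] theorem hom_ext {F G : BunFun m opn} {f g : F ⟶ G} (h : f.nat = g.nat) : f = g :=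
  Hom.ext h

@[simp] theorem id_nat (F : BunFun m opn) : Hom.nat (𝟙 F) = 𝟙 F.tot := rfl

@[simp] theorem comp_nat {F G H : BunFun m opn} (f : F ⟶ G) (g : G ⟶ H) :
    Hom.nat (f ≫ g) = f.nat ≫ g.nat := rfl

/-- A bundle functor preserves products. -/
abbrev PreservesProducts (F : BunFun m opn) : Prop := Limits.PreservesFiniteProducts F.tot

theorem over_app {F G : BunFun m opn} (f : F ⟶ G) (X : C) :
    f.nat.app X ≫ G.proj.app X = F.proj.app X := by
  rw [← NatTrans.comp_app, f.base]

theorem tot_comp (F : BunFun m opn) {X Y Z : C} (f : X ⟶ Y) (g : Y ⟶ Z) (x : F.tot.obj X) :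
    (F.tot.map g).toFun ((F.tot.map f).toFun x) = (F.tot.map (f ≫ g)).toFun x := by
  rw [Functor.map_comp]; rfl

theorem nat_apply {F G : BunFun m opn} (f : F ⟶ G) {X Y : C} (g : X ⟶ Y) (x : F.tot.obj X) :
    (f.nat.app Y).toFun ((F.tot.map g).toFun x) = (G.tot.map g).toFun ((f.nat.app X).toFun x) :=
  Mfd.congr_toFun (f.nat.naturality g) x

theorem proj_apply (F : BunFun m opn) {X Y : C} (g : X ⟶ Y) (x : F.tot.obj X) :
    (F.proj.app Y).toFun ((F.tot.map g).toFun x) = (m.map g).toFun ((F.proj.app X).toFun x) :=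
  Mfd.congr_toFun (F.proj.naturality g) x

/-- Replace the total spaces of a bundle functor by diffeomorphic ones. -/
def copy (F : BunFun m opn) (obj : C → Mfd) (e : ∀ X, F.tot.obj X ≅ obj X) : BunFun m opn where
  tot := F.tot.copyObj obj e
  proj := (F.tot.isoCopyObj obj e).inv ≫ F.proj
  surj X := (F.surj X).comp (Mfd.iso_surjective (e X).symm)
  subm X := (Mfd.isSubmersion_iso (e X).symm).comp (F.subm X)
  loc {X Y} i hi :=
    (Mfd.isOpenEmb_iso (e X).symm).comp ((F.loc i hi).comp (Mfd.isOpenEmb_iso (e Y)))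
  loc_range {X Y} i hi := by
    ext y
    have h1 := Set.ext_iff.1 (F.loc_range i hi) ((e Y).inv.toFun y)
    simp only [mem_range, mem_preimage] at h1 ⊢
    refine Iff.trans ?_ h1
    constructor
    · rintro ⟨x, rfl⟩
      exact ⟨(e X).inv.toFun x, (Mfd.iso_hom_inv (e Y) _).symm⟩
    · rintro ⟨x, hx⟩
      refine ⟨(e X).hom.toFun x, ?_⟩
      change (e Y).hom.toFun ((F.tot.map i).toFun ((e X).inv.toFun ((e X).hom.toFun x))) = y
      rw [Mfd.iso_hom_inv, hx]
      exact Mfd.iso_inv_hom (e Y) y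

/-- The canonical isomorphism between a bundle functor and a copy of it. -/
def copyIso (F : BunFun m opn) (obj : C → Mfd) (e : ∀ X, F.tot.obj X ≅ obj X) :
    F ≅ F.copy obj e where
  hom := ⟨(F.tot.isoCopyObj obj e).hom, (F.tot.isoCopyObj obj e).hom_inv_id_assoc F.proj⟩
  inv := ⟨(F.tot.isoCopyObj obj e).inv, rfl⟩
  hom_inv_id := by ext1; exact (F.tot.isoCopyObj obj e).hom_inv_id
  inv_hom_id := by ext1; exact (F.tot.isoCopyObj obj e).inv_hom_id

end BunFun

/-- Inclusions of open submanifolds. -/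
def Mfd.opens : MorphismProperty Mfd := fun _ _ f => Mfd.IsOpenEmb f

/-- Bundle functors `Mf ⥤ FM` on the category of manifolds. -/
abbrev BunMf := BunFun (𝟭 Mfd) Mfd.opens

namespace BunMf

variable (G : BunMf)

/-- Coordinates exhibit `ℝ^ι` as a product of lines. -/
noncomputable def eucIsLimit (ι : Type) [Finite ι] :
    Limits.IsLimit (Limits.Fan.mk (Mfd.euc ι) (Mfd.coord (ι := ι))) :=
  Limits.Fan.IsLimit.mk _ (fun f => Mfd.eucLift f.proj) (fun _ _ => rfl) fun f g h => by
    ext x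
    funext i
    exact Mfd.congr_toFun (h i) x

/-- For product preserving `G`, the value at `ℝ^ι` is a product. -/
noncomputable def mapEucIsLimit [G.PreservesProducts] (ι : Type) [Finite ι] :
    Limits.IsLimit (Limits.Fan.mk (G.tot.obj (Mfd.euc ι)) fun i : ι => G.tot.map (Mfd.coord i)) :=
  Limits.isLimitFanMkObjOfIsLimit G.tot _ _ (eucIsLimit ι)

theorem eq_of_coord [G.PreservesProducts] {ι : Type} [Finite ι] {x y : G.tot.obj (Mfd.euc ι)}
    (h : ∀ i, (G.tot.map (Mfd.coord i)).toFun x = (G.tot.map (Mfd.coord i)).toFun y) : x = y := by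
  refine Mfd.congr_toFun (f := Mfd.constHom Mfd.pt x) (g := Mfd.constHom Mfd.pt y) ?_ PUnit.unit
  refine Limits.Fan.IsLimit.hom_ext (mapEucIsLimit G ι) _ _ fun i => ?_
  ext
  exact h i

/-- A map into `G(ℝ^ι)` with given components in `G(ℝ)`. -/
noncomputable def coordLift [G.PreservesProducts] {ι : Type} [Finite ι] {Y : Mfd}
    (f : ι → (Y ⟶ G.tot.obj Mfd.line)) : Y ⟶ G.tot.obj (Mfd.euc ι) :=
  Limits.Fan.IsLimit.lift (mapEucIsLimit G ι) f

theorem coord_coordLift [G.PreservesProducts] {ι : Type} [Finite ι] {Y : Mfd}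
    (f : ι → (Y ⟶ G.tot.obj Mfd.line)) (i : ι) (y : Y) :
    (G.tot.map (Mfd.coord i)).toFun ((coordLift G f).toFun y) = (f i).toFun y :=
  Mfd.congr_toFun (Limits.Fan.IsLimit.fac (mapEucIsLimit G ι) f i) y

/-- For product preserving `G`, the value at the one-point manifold is terminal. -/
noncomputable def mapPtIsTerminal [G.PreservesProducts] :
    Limits.IsTerminal (G.tot.obj Mfd.pt) :=
  Limits.IsTerminal.isTerminalObj G.tot Mfd.pt Mfd.ptIsTerminal

end BunMf

/-! ### Multifibered manifolds -/

section MultiFib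

open scoped Manifold

/-- A projective system of manifolds `M_α` over `Λ`, with a manifold `tot` and maps
`π_α : tot → M_α` compatible with the system. -/
structure ProjSys (Λ : Type) [PartialOrder Λ] where
  diag : Λᵒᵖ ⥤ Mfd
  tot : Mfd
  π : ∀ α : Λ, tot ⟶ diag.obj (op α)
  π_comp : ∀ {α β : Λ} (h : α ≤ β), π β ≫ diag.map (homOfLE h).op = π α

namespace ProjSys

variable {Λ : Type} [PartialOrder Λ]

/-- The manifold `M_α`. -/
abbrev obj (X : ProjSys Λ) (α : Λ) : Mfd := X.diag.obj (op α)

/-- The projection `π_α^β : M_β → M_α`, for `α ≤ β`. -/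
abbrev pr (X : ProjSys Λ) {α β : Λ} (h : α ≤ β) : X.obj β ⟶ X.obj α := X.diag.map (homOfLE h).op

/-- The index set of the space `L_α` of the projective system `ξ(Λ, p)` of a map
`p : {1, …, n} → Λ`. -/
abbrev Idx {n : ℕ} (p : Fin n → Λ) (α : Λ) : Type := {i : Fin n // p i ≤ α}

/-- The projection `ξ_α : ℝⁿ → L_α = ℝ^{H_α}`, `H_α = {i | p i ≤ α}`, of `ξ(Λ, p)`. -/
noncomputable abbrev stdProj {n : ℕ} (p : Fin n → Λ) (α : Λ) :
    Mfd.euc (Fin n) ⟶ Mfd.euc (Idx p α) := Mfd.eucMap Subtype.val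

/-- The projection `ξ_α^β : L_β → L_α` of `ξ(Λ, p)`. -/
noncomputable abbrev stdPr {n : ℕ} (p : Fin n → Λ) {α β : Λ} (h : α ≤ β) :
    Mfd.euc (Idx p β) ⟶ Mfd.euc (Idx p α) := Mfd.eucMap fun i => ⟨i.1, i.2.trans h⟩

/-- Adapted charts centered at `x` and at all the points `x_α = π_α x`, modelled on `ξ(Λ, p)`.  They
are given by their inverses `σ = h⁻¹`, `σ_α = h_α⁻¹`, which, as the charts may be shrunk and
rescaled, are taken to be defined on the whole of `ℝⁿ` and `L_α`. -/
structure AdaptedChart (X : ProjSys Λ) {n : ℕ} (p : Fin n → Λ) (x : X.tot) where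
  σ : Mfd.euc (Fin n) ⟶ X.tot
  σ' : ∀ α, Mfd.euc (Idx p α) ⟶ X.obj α
  isOpenEmb : Mfd.IsOpenEmb σ
  isOpenEmb' : ∀ α, Mfd.IsOpenEmb (σ' α)
  center : σ.toFun (fun _ => 0) = x
  comm : ∀ α, σ ≫ X.π α = stdProj p α ≫ σ' α

namespace AdaptedChart

variable {X : ProjSys Λ} {n : ℕ} {p : Fin n → Λ} {x : X.tot} (A : AdaptedChart X p x)

theorem comm_pr {α β : Λ} (h : α ≤ β) : A.σ' β ≫ X.pr h = stdPr p h ≫ A.σ' α := by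
  classical
  ext v
  let w : Mfd.euc (Fin n) := fun i => if hi : p i ≤ β then v ⟨i, hi⟩ else 0
  have hw : (stdProj p β).toFun w = v := by
    funext i
    simp [w, Mfd.eucMap, i.2]
  have h1 := Mfd.congr_toFun (A.comm β) w
  have h2 := Mfd.congr_toFun (A.comm α) w
  have h3 := Mfd.congr_toFun (X.π_comp h) (A.σ.toFun w)
  simp only [Mfd.comp_toFun] at h1 h2 h3 ⊢
  rw [hw] at h1
  rw [← h1, h3, h2, ← hw]
  rfl

theorem center_mem (α : Λ) : (X.π α).toFun x ∈ range (A.σ' α).toFun := by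
  have h := congrArg (X.π α).toFun A.center
  exact ⟨_, (Mfd.congr_toFun (A.comm α) _).symm.trans h⟩

end AdaptedChart

end ProjSys

/-- A multifibered manifold `π = (M_α, π_α^β, Λ, M)`: a projective system of manifolds whose limit
`M` is a manifold, all the projections being surjective submersions, together with local adapted
charts modelled on a projective system `ξ(Λ, p)`. -/
structure MultiFib (Λ : Type) [PartialOrder Λ] extends ProjSys Λ where
  limit : ∀ x : (∀ α, toProjSys.obj α), (∀ α β (h : α ≤ β), (toProjSys.pr h).toFun (x β) = x α) →
    ∃! m : tot, ∀ α, (π α).toFun m = x α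
  surj : ∀ α, Function.Surjective (π α).toFun
  subm : ∀ α, Mfd.IsSubmersion (π α)
  surj_pr : ∀ {α β} (h : α ≤ β), Function.Surjective (toProjSys.pr h).toFun
  subm_pr : ∀ {α β} (h : α ≤ β), Mfd.IsSubmersion (toProjSys.pr h)
  adapted : ∃ (n : ℕ) (p : Fin n → Λ), ∀ x, Nonempty (toProjSys.AdaptedChart p x)

namespace MultiFib

variable {Λ : Type} [PartialOrder Λ]

/-- The category `FM_Λ`: a multifibered map is a family of smooth maps `f_α : M_α → M'_α` which
commute with the projections. -/
instance : Category (MultiFib Λ) where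
  Hom X Y := X.diag ⟶ Y.diag
  id X := 𝟙 X.diag
  comp f g := NatTrans.vcomp f g

/-- The component `f_α`. -/
def Hom.at {X Y : MultiFib Λ} (f : X ⟶ Y) (α : Λ) : X.obj α ⟶ Y.obj α :=
  NatTrans.app (F := X.diag) (G := Y.diag) f (op α)

@[ext] theorem hom_ext {X Y : MultiFib Λ} {f g : X ⟶ Y} (h : ∀ α, Hom.at f α = Hom.at g α) :
    f = g :=
  NatTrans.ext (funext fun α => h α.unop)

@[simp] theorem id_at (X : MultiFib Λ) (α : Λ) : Hom.at (𝟙 X) α = 𝟙 _ := rfl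

@[simp] theorem comp_at {X Y Z : MultiFib Λ} (f : X ⟶ Y) (g : Y ⟶ Z) (α : Λ) :
    Hom.at (f ≫ g) α = Hom.at f α ≫ Hom.at g α := rfl

theorem pr_at {X Y : MultiFib Λ} (f : X ⟶ Y) {α β : Λ} (h : α ≤ β) :
    X.pr h ≫ Hom.at f α = Hom.at f β ≫ Y.pr h :=
  NatTrans.naturality (F := X.diag) (G := Y.diag) f _

/-- A multifibered map from components indexed by `Λ`. -/
def mkHom {X Y : MultiFib Λ} (f : ∀ α, X.obj α ⟶ Y.obj α)
    (hf : ∀ {α β} (h : α ≤ β), X.pr h ≫ f α = f β ≫ Y.pr h) : X ⟶ Y :=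
  show X.diag ⟶ Y.diag from
  { app := fun α => f α.unop
    naturality := fun _ _ i => hf (leOfHom i.unop) }

@[simp] theorem mkHom_at {X Y : MultiFib Λ} (f : ∀ α, X.obj α ⟶ Y.obj α)
    (hf : ∀ {α β} (h : α ≤ β), X.pr h ≫ f α = f β ≫ Y.pr h) (α : Λ) :
    Hom.at (mkHom f hf) α = f α := rfl

theorem point_ext (X : MultiFib Λ) {x y : X.tot}
    (h : ∀ α, (X.π α).toFun x = (X.π α).toFun y) : x = y := by
  refine (X.limit (fun α => (X.π α).toFun y) fun α β h =>
    Mfd.congr_toFun (X.π_comp h) y).unique h fun _ => rfl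

theorem pr_trans (X : MultiFib Λ) {α β γ : Λ} (h : α ≤ β) (h' : β ≤ γ) :
    X.pr h' ≫ X.pr h = X.pr (h.trans h') := by
  rw [← Functor.map_comp]; rfl

theorem map_π (X : MultiFib Λ) {α β : Λ} (h : α ≤ β) (x : X.tot) :
    (X.pr h).toFun ((X.π β).toFun x) = (X.π α).toFun x :=
  Mfd.congr_toFun (X.π_comp h) x

/-- The map to the limit with given components is smooth. -/
noncomputable def lift [Finite Λ] (X : MultiFib Λ) {Y : Mfd} (f : ∀ α, Y ⟶ X.obj α)
    (hf : ∀ α β (h : α ≤ β), f β ≫ X.pr h = f α) : Y ⟶ X.tot where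
  toFun y := (X.limit (fun α => (f α).toFun y)
    fun α β h => Mfd.congr_toFun (hf α β h) y).exists.choose
  smooth := by
    set g : Y → X.tot := fun y => (X.limit (fun α => (f α).toFun y)
      fun α β h => Mfd.congr_toFun (hf α β h) y).exists.choose with hg
    have hgs : ∀ y α, (X.π α).toFun (g y) = (f α).toFun y := fun y =>
      (X.limit (fun α => (f α).toFun y)
        fun α β h => Mfd.congr_toFun (hf α β h) y).exists.choose_spec
    intro y₀
    obtain ⟨n, p, hA⟩ := X.adapted
    obtain ⟨A⟩ := hA (g y₀)
    have ho := A.isOpenEmb'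
    choose hop r hr hrs using ho
    have hV : ∀ᶠ y in 𝓝 y₀, ∀ α, (f α).toFun y ∈ range (A.σ' α).toFun := by
      rw [Filter.eventually_all]
      intro α
      refine (f α).smooth.continuous.continuousAt.preimage_mem_nhds ((hop α).mem_nhds ?_)
      rw [← hgs]
      exact A.center_mem α
    let := Fintype.ofFinite (Fin n)
    let z : Y → Mfd.euc (Fin n) := fun y i => r (p i) ((f (p i)).toFun y) ⟨i, le_rfl⟩
    have hz : ContMDiffAt 𝓘(ℝ, Y.E) 𝓘(ℝ, (Mfd.euc (Fin n)).E) ∞ z y₀ := by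
      refine contMDiffAt_pi_space.2 fun i => ?_
      have h1 := (hrs (p i)).contMDiffAt ((hop (p i)).mem_nhds (hV.self_of_nhds (p i)))
      exact ((Mfd.coord (⟨i, le_rfl⟩ : ProjSys.Idx p (p i))).smooth _).comp y₀
        (h1.comp y₀ ((f (p i)).smooth y₀))
    refine ((A.σ.smooth _).comp y₀ hz).congr_of_eventuallyEq ?_
    filter_upwards [hV] with y hy
    refine X.point_ext fun α => ?_
    have h1 := Mfd.congr_toFun (A.comm α) (z y)
    simp only [Mfd.comp_toFun] at h1
    rw [hgs, Function.comp_apply, h1]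
    obtain ⟨w, hw⟩ := hy α
    rw [← hw]
    congr 1
    funext i
    have h2 := Mfd.congr_toFun (A.comm_pr i.2) w
    have h3 := Mfd.congr_toFun (hf (p i) α i.2) y
    simp only [Mfd.comp_toFun] at h2 h3
    rw [hw, h3] at h2
    change w i = z y i
    simp only [z]
    rw [h2, hr]
    rfl

theorem π_lift [Finite Λ] (X : MultiFib Λ) {Y : Mfd} (f : ∀ α, Y ⟶ X.obj α)
    (hf : ∀ α β (h : α ≤ β), f β ≫ X.pr h = f α) (α : Λ) (y : Y) :
    (X.π α).toFun ((X.lift f hf).toFun y) = (f α).toFun y :=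
  (X.limit (fun α => (f α).toFun y)
    fun α β h => Mfd.congr_toFun (hf α β h) y).exists.choose_spec α

theorem base_compat {X Y : MultiFib Λ} (f : X ⟶ Y) (α β : Λ) (h : α ≤ β) :
    (X.π β ≫ Hom.at f β) ≫ Y.pr h = X.π α ≫ Hom.at f α := by
  rw [Category.assoc, ← pr_at, ← Category.assoc, X.π_comp]

/-- The functor `FM_Λ ⥤ Mf` assigning to `π` the manifold `M = lim M_α` and to a multifibered map
`(f_α)` the smooth map `f : M → M'` it determines. -/
noncomputable def base (Λ : Type) [PartialOrder Λ] [Finite Λ] : MultiFib Λ ⥤ Mfd where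
  obj X := X.tot
  map {X Y} f := Y.lift (fun α => X.π α ≫ Hom.at f α) (base_compat f)
  map_id X := by
    ext x
    refine X.point_ext fun α => ?_
    rw [π_lift]; rfl
  map_comp {X Y Z} f g := by
    ext x
    refine Z.point_ext fun α => ?_
    refine (Z.π_lift _ (base_compat (f ≫ g)) α x).trans ?_
    refine Eq.trans ?_ (Z.π_lift _ (base_compat g) α _).symm
    exact congrArg (Hom.at g α).toFun (Y.π_lift _ (base_compat f) α x).symm

theorem π_base [Finite Λ] {X Y : MultiFib Λ} (f : X ⟶ Y) (α : Λ) (x : X.tot) :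
    (Y.π α).toFun (((base Λ).map f).toFun x) = (Hom.at f α).toFun ((X.π α).toFun x) :=
  Y.π_lift _ (base_compat f) α x

/-- Inclusions of open multifibered submanifolds. -/
def opens (Λ : Type) [PartialOrder Λ] [Finite Λ] : MorphismProperty (MultiFib Λ) :=
  fun _ _ f => (∀ α, Mfd.IsOpenEmb (Hom.at f α)) ∧ Mfd.IsOpenEmb ((base Λ).map f)

end MultiFib

end MultiFib

/-- Bundle functors `FM_Λ ⥤ FM`. -/
abbrev BunFM (Λ : Type) [PartialOrder Λ] [Finite Λ] :=
  BunFun (MultiFib.base Λ) (MultiFib.opens Λ)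

/-! ### The functors `i_α : Mf ⥤ FM_Λ` -/

namespace Incl

open Classical in
/-- The manifold `X_γ`: equal to `X` if `α ≤ γ` and to the one-point manifold otherwise. -/
noncomputable def obj {Λ : Type} [PartialOrder Λ] (α : Λ) (X : Mfd) (γ : Λ) : Mfd :=
  if α ≤ γ then X else Mfd.pt

variable {Λ : Type} [PartialOrder Λ] {α : Λ} {X : Mfd}

/-- The identification `X_γ = X` for `α ≤ γ`. -/
noncomputable def toX {γ : Λ} (h : α ≤ γ) : obj α X γ ≅ X := eqToIso (if_pos h)

theorem obj_neg {γ : Λ} (h : ¬ α ≤ γ) : obj α X γ = Mfd.pt := if_neg h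

/-- The identification `X_γ = pt` for `α ≰ γ`. -/
noncomputable def toPt {γ : Λ} (h : ¬ α ≤ γ) : obj α X γ ≅ Mfd.pt := eqToIso (if_neg h)

theorem ext {γ : Λ} {Y : Mfd} {f g : Y ⟶ obj α X γ}
    (h : ∀ h : α ≤ γ, f ≫ (toX h).hom = g ≫ (toX h).hom) : f = g := by
  by_cases hc : α ≤ γ
  · exact (cancel_mono _).1 (h hc)
  · exact (cancel_mono (toPt hc).hom).1 (Mfd.hom_pt_ext _ _)

open Classical in
/-- The map to `X_γ` which is a given map to `X` if `α ≤ γ` and the map to the point otherwise. -/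
noncomputable def lift {γ : Λ} {Y : Mfd} (f : α ≤ γ → (Y ⟶ X)) : Y ⟶ obj α X γ :=
  if h : α ≤ γ then f h ≫ (toX h).inv else Mfd.toPt Y ≫ (toPt h).inv

@[simp]
theorem lift_toX {γ : Λ} {Y : Mfd} (f : α ≤ γ → (Y ⟶ X)) (h : α ≤ γ) :
    lift f ≫ (toX h).hom = f h := by
  simp [lift, h]

theorem lift_pos {γ : Λ} {Y : Mfd} (f : α ≤ γ → (Y ⟶ X)) (h : α ≤ γ) :
    lift f = f h ≫ (toX h).inv := by
  simp [lift, h]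

theorem surjective_neg {γ : Λ} {Y : Mfd} (f : Y ⟶ obj α X γ) (h : ¬ α ≤ γ) :
    Function.Surjective f.toFun := by
  generalize hN : obj α X γ = N at f
  rw [obj_neg h] at hN
  subst hN
  exact fun y => ⟨Classical.arbitrary Y, rfl⟩

theorem isSubmersion_neg {γ : Λ} {Y : Mfd} (f : Y ⟶ obj α X γ) (h : ¬ α ≤ γ) :
    Mfd.IsSubmersion f := by
  generalize hN : obj α X γ = N at f
  rw [obj_neg h] at hN
  subst hN
  exact fun x v => ⟨0, rfl⟩

theorem isOpenEmb_neg {γ : Λ} {Y : Mfd} (f : Y ⟶ obj α X γ) (h : ¬ α ≤ γ) [Subsingleton Y] :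
    Mfd.IsOpenEmb f := by
  generalize hN : obj α X γ = N at f
  rw [obj_neg h] at hN
  subst hN
  have h1 : range f.toFun = univ := eq_univ_of_forall fun y => ⟨Classical.arbitrary Y, rfl⟩
  exact ⟨by rw [h1]; exact isOpen_univ, (Mfd.constHom _ (Classical.arbitrary Y)).toFun,
    fun x => Subsingleton.elim _ _, (Mfd.constHom _ (Classical.arbitrary Y)).smooth.contMDiffOn⟩

/-- The projective system `(X_γ, r_δ^γ, Λ, X)`. -/
noncomputable def sys (α : Λ) (X : Mfd) : ProjSys Λ where
  diag :=
    { obj := fun γ => obj α X γ.unop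
      map := fun {γ δ} i => lift fun h => (toX (h.trans (leOfHom i.unop))).hom
      map_id := fun γ => ext fun h => by simp
      map_comp := fun f g => ext fun h => by simp }
  tot := X
  π γ := lift fun _ => 𝟙 X
  π_comp {γ δ} h := ext fun h => by simp

theorem sys_pr (α : Λ) (X : Mfd) {γ δ : Λ} (h : γ ≤ δ) :
    (sys α X).pr h = lift fun h' => (toX (h'.trans h)).hom := rfl

theorem sys_π (α : Λ) (X : Mfd) (γ : Λ) : (sys α X).π γ = lift fun _ => 𝟙 X := rfl

open scoped Manifold in
/-- Every point of a manifold is the center of a chart onto `ℝⁿ`. -/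
theorem exists_chart (X : Mfd) (x : X) :
    ∃ σ : Mfd.euc (Fin (Module.finrank ℝ X.E)) ⟶ X, Mfd.IsOpenEmb σ ∧ σ.toFun (fun _ => 0) = x := by
  let n := Module.finrank ℝ X.E
  let := Fintype.ofFinite (Fin n)
  let L : EuclideanSpace ℝ (Fin n) ≃L[ℝ] X.E := ContinuousLinearEquiv.ofFinrankEq (by
    rw [finrank_euclideanSpace, ← Nat.card_eq_fintype_card, Nat.card_fin])
  let e : EuclideanSpace ℝ (Fin n) ≃L[ℝ] (Fin n → ℝ) := EuclideanSpace.equiv (Fin n) ℝ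
  let φ := chartAt X.E x
  let c := L.symm (φ x)
  have hT : L ⁻¹' φ.target ∈ 𝓝 c := by
    refine (φ.open_target.preimage L.continuous).mem_nhds ?_
    simp only [c, mem_preimage, ContinuousLinearEquiv.apply_symm_apply]
    exact φ.map_source (mem_chart_source _ _)
  obtain ⟨r, hr, hB⟩ := Metric.mem_nhds_iff.1 hT
  let u := OpenPartialHomeomorph.univBall c r
  have hut : u.target = Metric.ball c r := OpenPartialHomeomorph.univBall_target c hr
  have hus : u.source = univ := OpenPartialHomeomorph.univBall_source c r
  have hu : ∀ v, u v ∈ Metric.ball c r := fun v => by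
    rw [← hut]; exact u.map_source (by rw [hus]; exact mem_univ _)
  let s : (Fin n → ℝ) → X := fun v => φ.symm (L (u (e.symm v)))
  let g : X → (Fin n → ℝ) := fun y => e (u.symm (L.symm (φ y)))
  have hφ : ContMDiffOn 𝓘(ℝ, X.E) 𝓘(ℝ, X.E) ∞ φ φ.source :=
    contMDiffOn_of_mem_maximalAtlas (IsManifold.subset_maximalAtlas (chart_mem_atlas _ _))
  have hφ' : ContMDiffOn 𝓘(ℝ, X.E) 𝓘(ℝ, X.E) ∞ φ.symm φ.target :=
    contMDiffOn_symm_of_mem_maximalAtlas (IsManifold.subset_maximalAtlas (chart_mem_atlas _ _))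
  have hs : ContMDiff 𝓘(ℝ, Fin n → ℝ) 𝓘(ℝ, X.E) ∞ s := by
    have h1 : ContMDiff 𝓘(ℝ, Fin n → ℝ) 𝓘(ℝ, X.E) ∞ fun v => L (u (e.symm v)) :=
      (L.contDiff.comp (OpenPartialHomeomorph.contDiff_univBall.comp e.symm.contDiff)).contMDiff
    exact contMDiffOn_univ.1 (hφ'.comp h1.contMDiffOn fun v _ => hB (hu _))
  have hgs : Function.LeftInverse g s := fun v => by
    simp only [g, s]
    rw [φ.right_inv (hB (hu _)), L.symm_apply_apply, u.left_inv (by rw [hus]; exact mem_univ _),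
      e.apply_symm_apply]
  have hrange : range s = φ.source ∩ φ ⁻¹' (L.symm ⁻¹' Metric.ball c r) := by
    ext y
    constructor
    · rintro ⟨v, rfl⟩
      refine ⟨φ.map_target (hB (hu _)), ?_⟩
      simp only [s, mem_preimage]
      rw [φ.right_inv (hB (hu _)), L.symm_apply_apply]
      exact hu _
    · rintro ⟨h1, h2⟩
      refine ⟨g y, ?_⟩
      simp only [g, s]
      rw [e.symm_apply_apply, u.right_inv (by rw [hut]; exact h2), L.apply_symm_apply,
        φ.left_inv h1]
  refine ⟨⟨s, hs⟩, ⟨?_, g, hgs, ?_⟩, ?_⟩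
  · change IsOpen (range s)
    rw [hrange]
    exact φ.isOpen_inter_preimage (Metric.isOpen_ball.preimage L.symm.continuous)
  · change ContMDiffOn 𝓘(ℝ, X.E) 𝓘(ℝ, Fin n → ℝ) ∞ g (range s)
    rw [hrange]
    have h1 : ContDiffOn ℝ ∞ (fun w => e (u.symm (L.symm w))) (L.symm ⁻¹' Metric.ball c r) :=
      e.contDiff.comp_contDiffOn (OpenPartialHomeomorph.contDiffOn_univBall_symm.comp
        L.symm.contDiff.contDiffOn fun w hw => hw)
    exact h1.contMDiffOn.comp (hφ.mono inter_subset_left) inter_subset_right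
  · change φ.symm (L (u (e.symm fun _ => 0))) = x
    have h0 : e.symm (fun _ => 0) = 0 := e.symm.map_zero
    rw [h0, OpenPartialHomeomorph.univBall_apply_zero]
    simp only [c, ContinuousLinearEquiv.apply_symm_apply]
    exact φ.left_inv (mem_chart_source _ _)

/-- The multifibered manifold `i_α(X)`. -/
noncomputable def fib (α : Λ) (X : Mfd) : MultiFib Λ where
  toProjSys := sys α X
  limit x hx := by
    refine ⟨(toX le_rfl).hom.toFun (x α), fun γ => ?_, fun m hm => ?_⟩
    · by_cases h : α ≤ γ
      · rw [sys_π, lift_pos _ h]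
        have h1 := hx α γ h
        rw [sys_pr, lift_pos _ le_rfl] at h1
        rw [← h1]
        change (toX h).inv.toFun ((toX le_rfl).hom.toFun ((toX le_rfl).inv.toFun
          ((toX (α := α) (X := X) h).hom.toFun (x γ)))) = x γ
        rw [Mfd.iso_inv_hom]
        exact Mfd.iso_hom_inv (toX (α := α) (X := X) h) (x γ)
      · have : Subsingleton ((sys α X).obj γ) := by
          change Subsingleton (obj α X γ)
          rw [obj_neg h]; exact inferInstanceAs (Subsingleton PUnit)
        exact Subsingleton.elim _ _
    · rw [← hm α, sys_π, lift_pos _ le_rfl]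
      exact (Mfd.iso_inv_hom (toX (α := α) (X := X) le_rfl) m).symm
  surj γ := by
    by_cases h : α ≤ γ
    · rw [sys_π, lift_pos _ h, Category.id_comp]
      exact Mfd.iso_surjective (toX h).symm
    · exact surjective_neg _ h
  subm γ := by
    by_cases h : α ≤ γ
    · rw [sys_π, lift_pos _ h, Category.id_comp]
      exact Mfd.isSubmersion_iso (toX h).symm
    · exact isSubmersion_neg _ h
  surj_pr {γ δ} h' := by
    by_cases h : α ≤ γ
    · rw [sys_pr, lift_pos _ h]
      exact Mfd.iso_surjective ((toX (h.trans h')) ≪≫ (toX h).symm)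
    · exact surjective_neg _ h
  subm_pr {γ δ} h' := by
    by_cases h : α ≤ γ
    · rw [sys_pr, lift_pos _ h]
      exact Mfd.isSubmersion_iso ((toX (h.trans h')) ≪≫ (toX h).symm)
    · exact isSubmersion_neg _ h
  adapted := by
    refine ⟨Module.finrank ℝ X.E, fun _ => α, fun x => ?_⟩
    obtain ⟨σ, hσ, h0⟩ := exists_chart X x
    refine ⟨⟨σ, fun γ => lift fun h => Mfd.eucMap (fun i => ⟨i, h⟩) ≫ σ, hσ, fun γ => ?_, h0,
      fun γ => ext fun h => ?_⟩⟩
    · by_cases h : α ≤ γ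
      · rw [lift_pos _ h]
        let e : Mfd.euc (ProjSys.Idx (fun _ : Fin (Module.finrank ℝ X.E) => α) γ) ≅
            Mfd.euc (Fin (Module.finrank ℝ X.E)) :=
          ⟨Mfd.eucMap fun i => ⟨i, h⟩, Mfd.eucMap Subtype.val, rfl, rfl⟩
        exact ((Mfd.isOpenEmb_iso e).comp hσ).comp (Mfd.isOpenEmb_iso (toX h).symm)
      · have : IsEmpty (ProjSys.Idx (fun _ : Fin (Module.finrank ℝ X.E) => α) γ) :=
          ⟨fun i => h i.2⟩
        have : Subsingleton (Mfd.euc (ProjSys.Idx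
            (fun _ : Fin (Module.finrank ℝ X.E) => α) γ)) :=
          inferInstanceAs (Subsingleton (_ → ℝ))
        exact isOpenEmb_neg _ h
    · have h1 : (sys α X).π γ ≫ (toX (α := α) (X := X) h).hom = 𝟙 X := lift_toX _ h
      have h2 := lift_toX (fun h => Mfd.eucMap (fun i => ⟨i, h⟩) ≫ σ :
        α ≤ γ → (Mfd.euc (ProjSys.Idx (fun _ => α) γ) ⟶ X)) h
      refine Eq.trans (b := σ) ?_ ?_
      · ext v
        exact Mfd.congr_toFun h1 (σ.toFun v)
      · ext v
        exact (Mfd.congr_toFun h2 ((ProjSys.stdProj (fun _ => α) γ).toFun v)).symm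

theorem fib_pr (α : Λ) (X : Mfd) {γ δ : Λ} (h : γ ≤ δ) :
    (fib α X).pr h = lift fun h' => (toX (h'.trans h)).hom := rfl

theorem fib_π (α : Λ) (X : Mfd) (γ : Λ) : (fib α X).π γ = lift fun _ => 𝟙 X := rfl

/-- The identification of the component of `i_α(X)` over `γ ≥ α` with `X`. -/
noncomputable def qF (α : Λ) (X : Mfd) {γ : Λ} (h : α ≤ γ) : (fib α X).obj γ ≅ X := toX h

theorem fib_pr_q (α : Λ) (X : Mfd) {γ δ : Λ} (h : γ ≤ δ) (h' : α ≤ γ) :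
    (fib α X).pr h ≫ (qF α X h').hom = (qF α X (h'.trans h)).hom := lift_toX _ _

/-- A multifibered map to `i_α(X)` is determined by its components over `γ ≥ α`. -/
theorem fib_ext {Y : MultiFib Λ} {f g : Y ⟶ fib α X}
    (h : ∀ γ (h : α ≤ γ), MultiFib.Hom.at f γ ≫ (qF α X h).hom =
      MultiFib.Hom.at g γ ≫ (qF α X h).hom) : f = g :=
  MultiFib.hom_ext fun γ => ext (h γ)

/-- The multifibered map to `i_α(X)` whose components over `γ ≥ α` are given maps to `X`. -/
noncomputable def mkHom (Y : MultiFib Λ) (f : ∀ γ, α ≤ γ → (Y.obj γ ⟶ X))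
    (hf : ∀ {γ δ} (h : γ ≤ δ) (h' : α ≤ γ), Y.pr h ≫ f γ h' = f δ (h'.trans h)) :
    Y ⟶ fib α X :=
  MultiFib.mkHom (fun γ => lift (f γ)) fun {γ δ} h => by
    refine ext fun h' => ?_
    have h1 : lift (f γ) ≫ (qF α X h').hom = f γ h' := lift_toX _ _
    have h2 : lift (f δ) ≫ (qF α X (h'.trans h)).hom = f δ (h'.trans h) := lift_toX _ _
    have h3 := fib_pr_q α X h h'
    have h4 := hf h h'
    rw [← h1, ← h2, ← h3] at h4
    exact h4

theorem mkHom_q (Y : MultiFib Λ) (f : ∀ γ, α ≤ γ → (Y.obj γ ⟶ X))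
    (hf : ∀ {γ δ} (h : γ ≤ δ) (h' : α ≤ γ), Y.pr h ≫ f γ h' = f δ (h'.trans h)) (γ : Λ)
    (h : α ≤ γ) : MultiFib.Hom.at (mkHom Y f hf) γ ≫ (qF α X h).hom = f γ h :=
  lift_toX _ _

/-- The multifibered map `i_α(X) → i_α(Y)` given by a map `X → Y`. -/
noncomputable def mapF (α : Λ) {X Y : Mfd} (f : X ⟶ Y) : fib α X ⟶ fib α Y :=
  mkHom (fib α X) (fun _ h => (qF α X h).hom ≫ f) fun h h' => by
    rw [← Category.assoc, fib_pr_q]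

theorem mapF_q (α : Λ) {X Y : Mfd} (f : X ⟶ Y) (γ : Λ) (h : α ≤ γ) :
    MultiFib.Hom.at (mapF α f) γ ≫ (qF α Y h).hom = (qF α X h).hom ≫ f :=
  mkHom_q (fib α X) _ (fun h h' => by rw [← Category.assoc, fib_pr_q]) γ h

/-- The map `i_α(X) → i_β(X)` given by the identity of `X`, for `α ≤ β`. -/
noncomputable def idF {α β : Λ} (h : α ≤ β) (X : Mfd) : fib α X ⟶ fib β X :=
  mkHom (fib α X) (fun _ h' => (qF α X (h.trans h')).hom) fun _ _ => fib_pr_q _ _ _ _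

theorem idF_q {α β : Λ} (h : α ≤ β) (X : Mfd) (γ : Λ) (h' : β ≤ γ) :
    MultiFib.Hom.at (idF h X) γ ≫ (qF β X h').hom = (qF α X (h.trans h')).hom :=
  mkHom_q (fib α X) (fun _ h' => (qF α X (h.trans h')).hom) (fun _ _ => fib_pr_q _ _ _ _) γ h'

/-- The functor `i_α : Mf ⥤ FM_Λ`. -/
noncomputable def functor (α : Λ) : Mfd ⥤ MultiFib Λ where
  obj X := fib α X
  map f := mapF α f
  map_id X := fib_ext fun γ h => by
    rw [mapF_q]; simp
  map_comp f g := fib_ext fun γ h => by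
    rw [mapF_q, MultiFib.comp_at, Category.assoc, mapF_q, ← Category.assoc, ← Category.assoc,
      mapF_q]

/-- The identification of the component of `i_α(X)` over `γ ≥ α` with `X`. -/
noncomputable def q (α : Λ) (X : Mfd) {γ : Λ} (h : α ≤ γ) : ((functor α).obj X).obj γ ≅ X :=
  qF α X h

theorem hom_ext {Y : MultiFib Λ} {f g : Y ⟶ (functor α).obj X}
    (h : ∀ γ (h : α ≤ γ), MultiFib.Hom.at f γ ≫ (q α X h).hom =
      MultiFib.Hom.at g γ ≫ (q α X h).hom) : f = g :=
  fib_ext h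

theorem pr_q (α : Λ) (X : Mfd) {γ δ : Λ} (h : γ ≤ δ) (h' : α ≤ γ) :
    ((functor α).obj X).pr h ≫ (q α X h').hom = (q α X (h'.trans h)).hom := fib_pr_q α X h h'

theorem π_q (α : Λ) (X : Mfd) {γ : Λ} (h : α ≤ γ) (x : X) :
    (q α X h).hom.toFun ((((functor α).obj X).π γ).toFun x) = x :=
  Mfd.congr_toFun (lift_toX (fun _ => 𝟙 X) h) x

theorem map_q (α : Λ) {X Y : Mfd} (f : X ⟶ Y) (γ : Λ) (h : α ≤ γ) :
    MultiFib.Hom.at ((functor α).map f) γ ≫ (q α Y h).hom = (q α X h).hom ≫ f :=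
  mapF_q α f γ h

/-- The components of `i_α(X)` over `γ ≱ α` are one-point manifolds. -/
noncomputable def qPt (α : Λ) (X : Mfd) {γ : Λ} (h : ¬ α ≤ γ) :
    ((functor α).obj X).obj γ ≅ Mfd.pt := toPt h

/-- The natural transformation `id_β^α : i_α ⟶ i_β`, for `α ≤ β`, consisting of the identity maps
of the manifolds `X`. -/
noncomputable def idTrans {α β : Λ} (h : α ≤ β) :
    functor (Λ := Λ) α ⟶ functor β where
  app X := idF h X
  naturality X Y f := fib_ext fun γ h' => by
    change (MultiFib.Hom.at (mapF α f) γ ≫ MultiFib.Hom.at (idF h Y) γ) ≫ _ =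
      (MultiFib.Hom.at (idF h X) γ ≫ MultiFib.Hom.at (mapF β f) γ) ≫ _
    rw [Category.assoc, Category.assoc, idF_q, mapF_q, mapF_q, ← Category.assoc, idF_q]

theorem idTrans_q {α β : Λ} (h : α ≤ β) (X : Mfd) (γ : Λ) (h' : β ≤ γ) :
    MultiFib.Hom.at ((idTrans h).app X) γ ≫ (q β X h').hom = (q α X (h.trans h')).hom :=
  idF_q h X γ h'

/-- The multifibered map `j_α : π → i_α(M_α)`, with components `π_α^γ` for `γ ≥ α`. -/
noncomputable def unit (α : Λ) (Y : MultiFib Λ) : Y ⟶ (functor α).obj (Y.obj α) :=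
  mkHom Y (fun _ h => Y.pr h) fun h h' => Y.pr_trans h' h

theorem unit_q (α : Λ) (Y : MultiFib Λ) (γ : Λ) (h : α ≤ γ) :
    MultiFib.Hom.at (unit α Y) γ ≫ (q α (Y.obj α) h).hom = Y.pr h :=
  mkHom_q Y _ _ _ _

theorem unit_naturality (α : Λ) {Y Z : MultiFib Λ} (f : Y ⟶ Z) :
    f ≫ unit α Z = unit α Y ≫ (functor α).map (MultiFib.Hom.at f α) :=
  hom_ext fun γ h => by
    rw [MultiFib.comp_at, MultiFib.comp_at, Category.assoc, Category.assoc, map_q,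
      unit_q, ← Category.assoc, unit_q, MultiFib.pr_at]

theorem unit_idTrans {α β : Λ} (h : α ≤ β) (Y : MultiFib Λ) :
    unit β Y ≫ (functor β).map (Y.pr h) = unit α Y ≫ (idTrans h).app (Y.obj α) :=
  hom_ext fun γ h' => by
    rw [MultiFib.comp_at, MultiFib.comp_at, Category.assoc, Category.assoc, map_q,
      idTrans_q, unit_q, ← Category.assoc, unit_q, MultiFib.pr_trans]

/-- The functor `π ↦ M_α`. -/
@[reducible] def eval (α : Λ) : MultiFib Λ ⥤ Mfd where
  obj Y := Y.obj α
  map f := MultiFib.Hom.at f α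

theorem adj_left {α : Λ} {Y : MultiFib Λ} {X : Mfd} (f : Y.obj α ⟶ X) :
    MultiFib.Hom.at (unit α Y ≫ (functor α).map f) α ≫ (q α X le_rfl).hom = f := by
  have h : Y.pr (le_refl α) = 𝟙 _ := Y.diag.map_id _
  rw [MultiFib.comp_at, Category.assoc, map_q, ← Category.assoc, unit_q, h, Category.id_comp]

theorem adj_right {α : Λ} {Y : MultiFib Λ} {X : Mfd} (g : Y ⟶ (functor α).obj X) :
    unit α Y ≫ (functor α).map (MultiFib.Hom.at g α ≫ (q α X le_rfl).hom) = g :=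
  hom_ext fun γ h => by
    rw [MultiFib.comp_at, Category.assoc, map_q, ← Category.assoc, unit_q, ← Category.assoc,
      MultiFib.pr_at, Category.assoc, pr_q]

theorem adj_nat {α : Λ} {Y Z : MultiFib Λ} {X : Mfd} (f : Y ⟶ Z) (g : Z ⟶ (functor α).obj X) :
    MultiFib.Hom.at (f ≫ g) α ≫ (q α X le_rfl).hom =
      MultiFib.Hom.at f α ≫ MultiFib.Hom.at g α ≫ (q α X le_rfl).hom := by
  rw [MultiFib.comp_at, Category.assoc]

/-- `i_α` is right adjoint to `π ↦ M_α`; hence it preserves products. -/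
noncomputable def adj (α : Λ) : eval α ⊣ functor α :=
  Adjunction.mkOfHomEquiv
    { homEquiv := fun Y X =>
        { toFun := fun f => unit α Y ≫ (functor α).map f
          invFun := fun g => MultiFib.Hom.at g α ≫ (q α X le_rfl).hom
          left_inv := fun f => adj_left f
          right_inv := fun g => adj_right g }
      homEquiv_naturality_left_symm := fun f g => adj_nat f g
      homEquiv_naturality_right := fun f g => by
        refine (congrArg (unit α _ ≫ ·) ((functor α).map_comp f g)).trans ?_
        exact (Category.assoc _ _ _).symm }

instance (α : Λ) : Limits.PreservesFiniteProducts (functor (Λ := Λ) α) :=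
  ⟨fun _ => ((adj α).rightAdjoint_preservesLimits).preservesLimitsOfShape⟩

variable [Finite Λ]

/-- The base map of `i_α(f)` is `f`. -/
theorem base_functor_map (α : Λ) {X Y : Mfd} (f : X ⟶ Y) (x : X) :
    ((MultiFib.base Λ).map ((functor α).map f)).toFun x = f.toFun x := by
  have h := π_q α Y (le_refl α) (((MultiFib.base Λ).map ((functor α).map f)).toFun x)
  refine h.symm.trans ?_
  refine (congrArg _ (MultiFib.π_base ((functor α).map f) α x)).trans ?_
  refine (Mfd.congr_toFun (map_q α f α le_rfl) _).trans ?_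
  exact congrArg f.toFun (π_q α X le_rfl x)

theorem base_idTrans {α β : Λ} (h : α ≤ β) (X : Mfd) (x : X) :
    ((MultiFib.base Λ).map ((idTrans h).app X)).toFun x = x := by
  have h' := π_q β X (le_refl β) (((MultiFib.base Λ).map ((idTrans h).app X)).toFun x)
  refine h'.symm.trans ?_
  refine (congrArg _ (MultiFib.π_base ((idTrans h).app X) β x)).trans ?_
  refine (Mfd.congr_toFun (idTrans_q h X β le_rfl) _).trans ?_
  exact π_q α X _ x

theorem opens_functor_map (α : Λ) {X Y : Mfd} (f : X ⟶ Y) (hf : Mfd.IsOpenEmb f) :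
    MultiFib.opens Λ ((functor α).map f) := by
  constructor
  · intro γ
    by_cases h : α ≤ γ
    · have h1 : MultiFib.Hom.at ((functor α).map f) γ =
          (q α X h).hom ≫ f ≫ (q α Y h).symm.hom := by
        rw [← Category.assoc, ← map_q, Category.assoc]
        simp
      rw [h1]
      exact (Mfd.isOpenEmb_iso _).comp (hf.comp (Mfd.isOpenEmb_iso _))
    · have : Subsingleton (((functor α).obj X).obj γ) :=
        ⟨fun x y => by
          rw [← Mfd.iso_hom_inv (qPt α X h) x, ← Mfd.iso_hom_inv (qPt α X h) y]
          rfl⟩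
      exact isOpenEmb_neg (α := α) (X := Y) _ h
  · have h1 : (MultiFib.base Λ).map ((functor α).map f) = f :=
      Mfd.hom_ext fun x => base_functor_map α f x
    rw [h1]
    exact hf

end Incl

/-- The bundle functor `G_α^F = F ∘ i_α : Mf ⥤ FM`. -/
noncomputable def BunFM.restrict {Λ : Type} [PartialOrder Λ] [Finite Λ] (F : BunFM Λ) (α : Λ) :
    BunMf where
  tot := Incl.functor α ⋙ F.tot
  proj :=
    { app := fun X => F.proj.app ((Incl.functor α).obj X)
      naturality := fun X Y f => by
        refine (F.proj.naturality ((Incl.functor α).map f)).trans ?_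
        ext x
        exact Incl.base_functor_map α f _ }
  surj X := F.surj _
  subm X := F.subm _
  loc i hi := F.loc _ (Incl.opens_functor_map α i hi)
  loc_range {X Y} i hi := by
    refine (F.loc_range _ (Incl.opens_functor_map α i hi)).trans ?_
    have h1 : ((MultiFib.base Λ).map ((Incl.functor α).map i)).toFun = i.toFun :=
      funext fun x => Incl.base_functor_map α i x
    rw [h1]
    rfl

instance {Λ : Type} [PartialOrder Λ] [Finite Λ] (F : BunFM Λ) [F.PreservesProducts] (α : Λ) :
    (F.restrict α).PreservesProducts :=
  inferInstanceAs (Limits.PreservesFiniteProducts (Incl.functor α ⋙ F.tot))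

/-- The inductive system `μ^F` over `Λ` of natural transformations
`(μ^F)_β^α = F(id_β^α) : G_α^F ⟶ G_β^F`. -/
noncomputable def BunFM.indSys {Λ : Type} [PartialOrder Λ] [Finite Λ] (F : BunFM Λ) :
    Λ ⥤ BunMf where
  obj α := F.restrict α
  map {α β} h :=
    show BunFun.Hom (F.restrict α) (F.restrict β) from
    ⟨Functor.whiskerRight (Incl.idTrans (leOfHom h)) F.tot, by
      ext X x
      refine (Mfd.congr_toFun (F.proj.naturality ((Incl.idTrans (leOfHom h)).app X)) x).trans ?_
      exact Incl.base_idTrans (leOfHom h) X _⟩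
  map_id α := by
    refine BunFun.hom_ext ?_
    ext X : 2
    refine (congrArg F.tot.map (Incl.hom_ext (g := 𝟙 _) fun γ h => ?_)).trans (F.tot.map_id _)
    rw [Incl.idTrans_q]
    exact (Category.id_comp _).symm
  map_comp {α β γ} h h' := by
    refine BunFun.hom_ext ?_
    ext X : 2
    refine (congrArg F.tot.map (Incl.hom_ext (g := (Incl.idTrans (leOfHom h)).app X ≫
      (Incl.idTrans (leOfHom h')).app X) fun δ hδ => ?_)).trans (F.tot.map_comp _ _)
    rw [Incl.idTrans_q, MultiFib.comp_at, Category.assoc, Incl.idTrans_q, Incl.idTrans_q]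

/-! ### The bundle functor `∏_μ G_α` -/

namespace IndSys

set_option linter.unusedSectionVars false

open scoped Manifold

variable {Λ : Type} [PartialOrder Λ] [Finite Λ] (μ : Λ ⥤ BunMf)

/-- The natural transformation `μ_β^α : G_α ⟶ G_β` of an inductive system, for `α ≤ β`. -/
abbrev tr {α β : Λ} (h : α ≤ β) : μ.obj α ⟶ μ.obj β := μ.map (homOfLE h)

/-- The component `μ_β^α(X) : G_α(X) → G_β(X)`. -/
noncomputable abbrev trApp {α β : Λ} (h : α ≤ β) (X : Mfd) :
    (μ.obj α).tot.obj X ⟶ (μ.obj β).tot.obj X := (tr μ h).nat.app X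

theorem trApp_refl (α : Λ) (X : Mfd) (x : (μ.obj α).tot.obj X) :
    (trApp μ (le_refl α) X).toFun x = x := by
  have h : tr μ (le_refl α) = 𝟙 _ := μ.map_id α
  rw [trApp, h]
  rfl

theorem trApp_trans {α β γ : Λ} (h : α ≤ β) (h' : β ≤ γ) (X : Mfd) (x : (μ.obj α).tot.obj X) :
    (trApp μ h' X).toFun ((trApp μ h X).toFun x) = (trApp μ (h.trans h') X).toFun x := by
  have h1 : tr μ (h.trans h') = tr μ h ≫ tr μ h' := μ.map_comp _ _
  rw [trApp, trApp, trApp, h1]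
  rfl

/-- The set `∏_μ G_α(π) ⊆ ∏_α G_α(M_α)` of the families `(x_α)` such that
`G_β(π_α^β)(x_β) = μ_β^α(M_α)(x_α)` for all `α ≤ β`. -/
def prodSet (X : MultiFib Λ) : Set (Mfd.pi fun α => (μ.obj α).tot.obj (X.obj α)) :=
  {x | ∀ (α β : Λ) (h : α ≤ β),
    ((μ.obj β).tot.map (X.pr h)).toFun (x β) = (trApp μ h (X.obj α)).toFun (x α)}

/-- The base point `(p(x_α))` of an element of `∏_μ G_α(π)` is compatible with the projections. -/
theorem prodSet_base {X : MultiFib Λ} {x : Mfd.pi fun α => (μ.obj α).tot.obj (X.obj α)}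
    (hx : x ∈ prodSet μ X) {α β : Λ} (h : α ≤ β) :
    (X.pr h).toFun (((μ.obj β).proj.app (X.obj β)).toFun (x β)) =
      ((μ.obj α).proj.app (X.obj α)).toFun (x α) := by
  have h1 := (μ.obj β).proj_apply (X.pr h) (x β)
  have h2 := Mfd.congr_toFun (BunFun.over_app (tr μ h) (X.obj α)) (x α)
  refine h1.symm.trans ?_
  rw [hx α β h]
  exact h2

section Param

variable [∀ α, (μ.obj α).PreservesProducts] {X : MultiFib Λ} {n : ℕ} {p : Fin n → Λ} {x : X.tot}
  (A : X.toProjSys.AdaptedChart p x)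

/-- The manifold `∏_i G_{p(i)}(ℝ)` which parametrizes `∏_μ G_α(π)` locally. -/
noncomputable def model {n : ℕ} (p : Fin n → Λ) : Mfd :=
  Mfd.pi fun i => (μ.obj (p i)).tot.obj Mfd.line

/-- The map `∏_i G_{p(i)}(ℝ) → G_α(L_α)`. -/
noncomputable def paramStd {n : ℕ} (p : Fin n → Λ) (α : Λ) :
    model μ p ⟶ (μ.obj α).tot.obj (Mfd.euc (ProjSys.Idx p α)) :=
  BunMf.coordLift (μ.obj α) fun i => Mfd.piProj _ i.1 ≫ trApp μ i.2 Mfd.line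

theorem paramStd_coord {n : ℕ} (p : Fin n → Λ) (α : Λ) (i : ProjSys.Idx p α) (y : model μ p) :
    ((μ.obj α).tot.map (Mfd.coord i)).toFun ((paramStd μ p α).toFun y) =
      (trApp μ i.2 Mfd.line).toFun (y i.1) :=
  BunMf.coord_coordLift (μ.obj α) _ i y

theorem paramStd_compat {n : ℕ} (p : Fin n → Λ) {α β : Λ} (h : α ≤ β) (y : model μ p) :
    ((μ.obj β).tot.map (ProjSys.stdPr p h)).toFun ((paramStd μ p β).toFun y) =
      (trApp μ h _).toFun ((paramStd μ p α).toFun y) := by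
  refine BunMf.eq_of_coord _ fun i => ?_
  rw [BunFun.tot_comp, ← BunFun.nat_apply, paramStd_coord, trApp_trans]
  exact paramStd_coord μ p β ⟨i.1, i.2.trans h⟩ y

/-- The local parametrization of `∏_μ G_α(π)` given by an adapted chart. -/
noncomputable def param : model μ p ⟶ Mfd.pi fun α => (μ.obj α).tot.obj (X.obj α) :=
  Mfd.piLift fun α => paramStd μ p α ≫ (μ.obj α).tot.map (A.σ' α)

theorem param_apply (y : model μ p) (α : Λ) :
    (param μ A).toFun y α = ((μ.obj α).tot.map (A.σ' α)).toFun ((paramStd μ p α).toFun y) := rfl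

theorem param_mem (y : model μ p) : (param μ A).toFun y ∈ prodSet μ X := by
  intro α β h
  rw [param_apply, param_apply, BunFun.tot_comp, BunFun.nat_apply, ← paramStd_compat,
    BunFun.tot_comp]
  rw [show A.σ' β ≫ X.pr h = _ from A.comm_pr h]

theorem exists_param (x₀ : X.tot) (A : X.toProjSys.AdaptedChart p x₀) :
    ∃ (W : Set (Mfd.pi fun α => (μ.obj α).tot.obj (X.obj α)))
      (ρ : (Mfd.pi fun α => (μ.obj α).tot.obj (X.obj α)) → model μ p),
      IsOpen W ∧ (∀ s ∈ prodSet μ X, (∀ α, ((μ.obj α).proj.app (X.obj α)).toFun (s α) =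
        (X.π α).toFun x₀) → s ∈ W) ∧
      ContMDiffOn 𝓘(ℝ, (Mfd.pi fun α => (μ.obj α).tot.obj (X.obj α)).E)
        𝓘(ℝ, (model μ p).E) ∞ ρ W ∧
      Function.LeftInverse ρ (param μ A).toFun ∧
      range (param μ A).toFun = prodSet μ X ∩ W := by
  have ho := fun α => (μ.obj α).loc (A.σ' α) (A.isOpenEmb' α)
  choose hop r hr hrs using ho
  let W : Set (Mfd.pi fun α => (μ.obj α).tot.obj (X.obj α)) :=
    ⋂ α, {s | s α ∈ range ((μ.obj α).tot.map (A.σ' α)).toFun}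
  let ρ : (Mfd.pi fun α => (μ.obj α).tot.obj (X.obj α)) → model μ p := fun s i =>
    ((μ.obj (p i)).tot.map (Mfd.coord (⟨i, le_rfl⟩ : ProjSys.Idx p (p i)))).toFun
      (r (p i) (s (p i)))
  have hW : IsOpen W := isOpen_iInter_of_finite fun α =>
    (hop α).preimage (Mfd.piProj (fun α => (μ.obj α).tot.obj (X.obj α)) α).smooth.continuous
  have hρ : Function.LeftInverse ρ (param μ A).toFun := fun y => by
    refine Mfd.pi_ext fun i => ?_
    simp only [ρ, param_apply]
    rw [hr, paramStd_coord, trApp_refl]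
  refine ⟨W, ρ, hW, ?_, ?_, hρ, ?_⟩
  · intro s hs hb
    refine mem_iInter.2 fun α => ?_
    change s α ∈ range ((μ.obj α).tot.map (A.σ' α)).toFun
    rw [(μ.obj α).loc_range (A.σ' α) (A.isOpenEmb' α)]
    change ((μ.obj α).proj.app (X.obj α)).toFun (s α) ∈ range (A.σ' α).toFun
    rw [hb]
    exact A.center_mem α
  · refine Mfd.pi_smooth_iff _ _ fun i => ?_
    refine ((μ.obj (p i)).tot.map (Mfd.coord (⟨i, le_rfl⟩ : ProjSys.Idx p (p i)))).smooth.comp_contMDiffOn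
      ((hrs (p i)).comp
        (Mfd.piProj (fun α => (μ.obj α).tot.obj (X.obj α)) (p i)).smooth.contMDiffOn ?_)
    intro s hs
    exact mem_iInter.1 hs (p i)
  · ext s
    constructor
    · rintro ⟨y, rfl⟩
      refine ⟨param_mem μ A y, mem_iInter.2 fun α => ⟨_, (param_apply μ A y α).symm⟩⟩
    · rintro ⟨hs, hsW⟩
      refine ⟨ρ s, Mfd.pi_ext fun α => ?_⟩
      have hw : ∀ α, ((μ.obj α).tot.map (A.σ' α)).toFun (r α (s α)) = s α := fun α => by
        obtain ⟨w, hw⟩ := mem_iInter.1 hsW α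
        rw [← hw, hr]
      rw [param_apply]
      refine Eq.trans ?_ (hw α)
      congr 1
      refine BunMf.eq_of_coord _ fun i => ?_
      rw [paramStd_coord]
      have h1 := hs (p i.1) α i.2
      rw [← hw α, ← hw (p i.1), BunFun.tot_comp, BunFun.nat_apply,
        show A.σ' α ≫ X.pr i.2 = _ from A.comm_pr i.2, ← BunFun.tot_comp] at h1
      have h2 := ((μ.obj α).loc (A.σ' (p i.1)) (A.isOpenEmb' _)).injective h1
      simp only [ρ]
      rw [BunFun.nat_apply, ← h2, BunFun.tot_comp]
      rfl

theorem exists_base (X : MultiFib Λ)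
    {s : Mfd.pi fun α => (μ.obj α).tot.obj (X.obj α)} (hs : s ∈ prodSet μ X) :
    ∃ x₀ : X.tot, ∀ α, ((μ.obj α).proj.app (X.obj α)).toFun (s α) = (X.π α).toFun x₀ := by
  obtain ⟨x₀, h, -⟩ := X.limit (fun α => ((μ.obj α).proj.app (X.obj α)).toFun (s α))
    fun α β h => prodSet_base μ hs h
  exact ⟨x₀, fun α => (h α).symm⟩

/-- `∏_μ G_α(π)` is a submanifold of `∏_α G_α(M_α)`. -/
theorem isSubmfd (X : MultiFib Λ) :
    Mfd.IsSubmfd (Mfd.pi fun α => (μ.obj α).tot.obj (X.obj α)) (prodSet μ X) := by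
  obtain ⟨n, p, hA⟩ := X.adapted
  obtain ⟨A₀⟩ := hA (Classical.arbitrary X.tot)
  refine ⟨⟨_, param_mem μ A₀ (Classical.arbitrary _)⟩, model μ p, fun s hs => ?_⟩
  obtain ⟨x₀, hx₀⟩ := exists_base μ X hs
  obtain ⟨A⟩ := hA x₀
  obtain ⟨W, ρ, h1, h2, h3, h4, h5⟩ := exists_param μ x₀ A
  exact ⟨param μ A, W, ρ, h1, h2 s hs hx₀, h3, h4, h5⟩

end Param

variable [∀ α, (μ.obj α).PreservesProducts]

/-- The manifold `∏_μ G_α(π)`. -/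
noncomputable def prodObj (X : MultiFib Λ) : Mfd := (isSubmfd μ X).mfd

/-- The components `∏_μ G_α(π) → G_α(M_α)` of the inclusion. -/
noncomputable def comp (X : MultiFib Λ) (α : Λ) : prodObj μ X ⟶ (μ.obj α).tot.obj (X.obj α) :=
  (isSubmfd μ X).incl ≫ Mfd.piProj _ α

theorem comp_compat (X : MultiFib Λ) (s : prodObj μ X) (α β : Λ) (h : α ≤ β) :
    ((μ.obj β).tot.map (X.pr h)).toFun ((comp μ X β).toFun s) =
      (trApp μ h (X.obj α)).toFun ((comp μ X α).toFun s) :=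
  (isSubmfd μ X).incl_mem s α β h

theorem prod_ext {X : MultiFib Λ} {s t : prodObj μ X}
    (h : ∀ α, (comp μ X α).toFun s = (comp μ X α).toFun t) : s = t :=
  (isSubmfd μ X).incl_injective (Mfd.pi_ext h)

/-- A smooth map to `∏_μ G_α(π)` with given components. -/
noncomputable def prodLift {X : MultiFib Λ} {Z : Mfd}
    (f : ∀ α, Z ⟶ (μ.obj α).tot.obj (X.obj α))
    (hf : ∀ (z : Z) (α β : Λ) (h : α ≤ β), ((μ.obj β).tot.map (X.pr h)).toFun ((f β).toFun z) =
      (trApp μ h (X.obj α)).toFun ((f α).toFun z)) : Z ⟶ prodObj μ X :=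
  (isSubmfd μ X).lift (Mfd.piLift f) hf

theorem comp_prodLift {X : MultiFib Λ} {Z : Mfd}
    (f : ∀ α, Z ⟶ (μ.obj α).tot.obj (X.obj α))
    (hf : ∀ (z : Z) (α β : Λ) (h : α ≤ β), ((μ.obj β).tot.map (X.pr h)).toFun ((f β).toFun z) =
      (trApp μ h (X.obj α)).toFun ((f α).toFun z)) (α : Λ) (z : Z) :
    (comp μ X α).toFun ((prodLift μ f hf).toFun z) = (f α).toFun z := rfl

/-- The projection `p_μ(π) : ∏_μ G_α(π) → M`. -/
noncomputable def prodProj (X : MultiFib Λ) : prodObj μ X ⟶ X.tot :=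
  X.lift (fun α => comp μ X α ≫ (μ.obj α).proj.app (X.obj α)) fun α β h => by
    ext s
    exact prodSet_base μ ((isSubmfd μ X).incl_mem s) h

theorem π_prodProj (X : MultiFib Λ) (α : Λ) (s : prodObj μ X) :
    (X.π α).toFun ((prodProj μ X).toFun s) =
      ((μ.obj α).proj.app (X.obj α)).toFun ((comp μ X α).toFun s) :=
  X.π_lift (fun α => comp μ X α ≫ (μ.obj α).proj.app (X.obj α)) _ α s

theorem prodMap_compat {X Y : MultiFib Λ} (f : X ⟶ Y) (s : prodObj μ X) (α β : Λ) (h : α ≤ β) :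
    ((μ.obj β).tot.map (Y.pr h)).toFun
        ((comp μ X β ≫ (μ.obj β).tot.map (MultiFib.Hom.at f β)).toFun s) =
      (trApp μ h (Y.obj α)).toFun
        ((comp μ X α ≫ (μ.obj α).tot.map (MultiFib.Hom.at f α)).toFun s) := by
  rw [Mfd.comp_toFun, Mfd.comp_toFun, BunFun.tot_comp, BunFun.nat_apply, ← comp_compat,
    BunFun.tot_comp, MultiFib.pr_at]

/-- The map `∏_μ G_α(f)`, the restriction of `∏_α G_α(f_α)`. -/
noncomputable def prodMap {X Y : MultiFib Λ} (f : X ⟶ Y) : prodObj μ X ⟶ prodObj μ Y :=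
  prodLift μ (fun α => comp μ X α ≫ (μ.obj α).tot.map (MultiFib.Hom.at f α)) (prodMap_compat μ f)

theorem comp_prodMap {X Y : MultiFib Λ} (f : X ⟶ Y) (s : prodObj μ X) (α : Λ) :
    (comp μ Y α).toFun ((prodMap μ f).toFun s) =
      ((μ.obj α).tot.map (MultiFib.Hom.at f α)).toFun ((comp μ X α).toFun s) := rfl

theorem prodProj_naturality {X Y : MultiFib Λ} (f : X ⟶ Y) :
    prodMap μ f ≫ prodProj μ Y = prodProj μ X ≫ (MultiFib.base Λ).map f := by
  ext s
  refine Y.point_ext fun α => ?_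
  refine (π_prodProj μ Y α ((prodMap μ f).toFun s)).trans
    (Eq.trans ?_ (MultiFib.π_base f α ((prodProj μ X).toFun s)).symm)
  refine ((μ.obj α).proj_apply (MultiFib.Hom.at f α) ((comp μ X α).toFun s)).trans ?_
  exact congrArg (MultiFib.Hom.at f α).toFun (π_prodProj μ X α s).symm

/-- The product of the base projections `∏_i G_{p(i)}(ℝ) → ℝⁿ`. -/
noncomputable def modelProj {n : ℕ} (p : Fin n → Λ) : model μ p ⟶ Mfd.euc (Fin n) :=
  Mfd.eucLift fun i => Mfd.piProj _ i ≫ (μ.obj (p i)).proj.app Mfd.line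

theorem modelProj_surjective {n : ℕ} (p : Fin n → Λ) :
    Function.Surjective (modelProj μ p).toFun := fun v => by
  choose y hy using fun i => (μ.obj (p i)).surj Mfd.line (v i)
  exact ⟨y, funext hy⟩

theorem modelProj_isSubmersion {n : ℕ} (p : Fin n → Λ) : Mfd.IsSubmersion (modelProj μ p) :=
  Mfd.isSubmersion_eucLift _ fun i => (μ.obj (p i)).subm Mfd.line

/-- A local parametrization, as a map to `∏_μ G_α(π)`. -/
noncomputable def paramProd {X : MultiFib Λ} {n : ℕ} {p : Fin n → Λ} {x : X.tot}
    (A : X.toProjSys.AdaptedChart p x) : model μ p ⟶ prodObj μ X :=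
  (isSubmfd μ X).lift (param μ A) (param_mem μ A)

theorem paramStd_proj {n : ℕ} (p : Fin n → Λ) (α : Λ) (y : model μ p) :
    ((μ.obj α).proj.app _).toFun ((paramStd μ p α).toFun y) =
      (ProjSys.stdProj p α).toFun ((modelProj μ p).toFun y) := by
  funext i
  have h1 := (μ.obj α).proj_apply (Mfd.coord i) ((paramStd μ p α).toFun y)
  rw [paramStd_coord] at h1
  exact h1.symm.trans (Mfd.congr_toFun (BunFun.over_app (tr μ i.2) Mfd.line) (y i.1))

theorem paramProd_proj {X : MultiFib Λ} {n : ℕ} {p : Fin n → Λ} {x : X.tot}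
    (A : X.toProjSys.AdaptedChart p x) :
    paramProd μ A ≫ prodProj μ X = modelProj μ p ≫ A.σ := by
  ext y
  refine X.point_ext fun α => ?_
  rw [Mfd.comp_toFun, Mfd.comp_toFun, π_prodProj]
  have h1 := Mfd.congr_toFun (A.comm α) ((modelProj μ p).toFun y)
  have h2 := (μ.obj α).proj_apply (A.σ' α) ((paramStd μ p α).toFun y)
  refine h2.trans (Eq.trans ?_ h1.symm)
  exact congrArg (A.σ' α).toFun (paramStd_proj μ p α y)

theorem prodProj_surjective (X : MultiFib Λ) : Function.Surjective (prodProj μ X).toFun := by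
  intro x
  obtain ⟨n, p, hA⟩ := X.adapted
  obtain ⟨A⟩ := hA x
  obtain ⟨y, hy⟩ := modelProj_surjective μ p fun _ => 0
  refine ⟨(paramProd μ A).toFun y, ?_⟩
  refine (Mfd.congr_toFun (paramProd_proj μ A) y).trans ?_
  rw [Mfd.comp_toFun, hy]
  exact A.center

theorem prodProj_isSubmersion (X : MultiFib Λ) : Mfd.IsSubmersion (prodProj μ X) := by
  intro s
  obtain ⟨n, p, hA⟩ := X.adapted
  obtain ⟨A⟩ := hA ((prodProj μ X).toFun s)
  obtain ⟨W, ρ, h1, h2, h3, h4, h5⟩ := exists_param μ _ A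
  have hs : (isSubmfd μ X).incl.toFun s ∈ range (param μ A).toFun := by
    rw [h5]
    refine ⟨(isSubmfd μ X).incl_mem s, h2 _ ((isSubmfd μ X).incl_mem s) fun α => ?_⟩
    exact (π_prodProj μ X α s).symm
  obtain ⟨y, hy⟩ := hs
  have hy' : (paramProd μ A).toFun y = s := (isSubmfd μ X).incl_injective hy
  rw [← hy']
  refine Mfd.surjective_of_comp _ _ _ ?_
  rw [paramProd_proj]
  exact ((modelProj_isSubmersion μ p).comp A.isOpenEmb.isSubmersion) y

theorem prodMap_range {X Y : MultiFib Λ} (i : X ⟶ Y) (hi : MultiFib.opens Λ i) :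
    range (prodMap μ i).toFun =
      (prodProj μ Y).toFun ⁻¹' range ((MultiFib.base Λ).map i).toFun := by
  ext t
  constructor
  · rintro ⟨s, rfl⟩
    exact ⟨(prodProj μ X).toFun s, (Mfd.congr_toFun (prodProj_naturality μ i) s).symm⟩
  · rintro ⟨m, hm⟩
    have h1 : ∀ α, (comp μ Y α).toFun t ∈
        range ((μ.obj α).tot.map (MultiFib.Hom.at i α)).toFun := fun α => by
      rw [(μ.obj α).loc_range _ (hi.1 α)]
      change ((μ.obj α).proj.app (Y.obj α)).toFun ((comp μ Y α).toFun t) ∈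
        range (MultiFib.Hom.at i α).toFun
      exact ⟨(X.π α).toFun m, (MultiFib.π_base i α m).symm.trans
        ((congrArg (Y.π α).toFun hm).trans (π_prodProj μ Y α t))⟩
    choose u hu using h1
    have hmem : u ∈ prodSet μ X := fun α β h => by
      refine ((μ.obj β).loc _ (hi.1 α)).injective ?_
      rw [BunFun.tot_comp, ← BunFun.nat_apply, hu, MultiFib.pr_at, ← BunFun.tot_comp, hu]
      exact comp_compat μ Y t α β h
    refine ⟨(⟨u, hmem⟩ : prodSet μ X), ?_⟩
    exact prod_ext μ hu

theorem prodMap_isOpenEmb {X Y : MultiFib Λ} (i : X ⟶ Y) (hi : MultiFib.opens Λ i) :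
    Mfd.IsOpenEmb (prodMap μ i) := by
  have hinj : Function.Injective (prodMap μ i).toFun := fun s t hst =>
    prod_ext μ fun α => ((μ.obj α).loc _ (hi.1 α)).injective
      (congrArg (comp μ Y α).toFun hst)
  have ho := fun α => (μ.obj α).loc _ (hi.1 α)
  choose hop r hr hrs using ho
  refine ⟨?_, Function.invFun (prodMap μ i).toFun, Function.leftInverse_invFun hinj, ?_⟩
  · rw [prodMap_range μ i hi]
    exact hi.2.1.preimage (prodProj μ Y).smooth.continuous
  · refine (isSubmfd μ X).smoothOn_of_comp _ _ ?_
    refine Mfd.pi_smooth_iff _ _ fun α => ?_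
    have h1 : ContMDiffOn 𝓘(ℝ, (prodObj μ Y).E) 𝓘(ℝ, ((μ.obj α).tot.obj (X.obj α)).E) ∞
        (fun t => r α ((comp μ Y α).toFun t)) (range (prodMap μ i).toFun) := by
      refine (hrs α).comp (comp μ Y α).smooth.contMDiffOn ?_
      rintro _ ⟨s, rfl⟩
      exact ⟨_, (comp_prodMap μ i s α).symm⟩
    refine h1.congr ?_
    rintro _ ⟨s, rfl⟩
    rw [Function.leftInverse_invFun hinj, comp_prodMap, hr]
    rfl

/-- The bundle functor `∏_μ G_α : FM_Λ ⥤ FM`. -/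
noncomputable def prod : BunFM Λ where
  tot :=
    { obj := prodObj μ
      map := prodMap μ
      map_id := fun X => by
        ext s
        refine prod_ext μ fun α => ?_
        rw [comp_prodMap]
        exact Mfd.congr_toFun ((μ.obj α).tot.map_id _) _
      map_comp := fun f g => by
        ext s
        refine prod_ext μ fun α => ?_
        rw [comp_prodMap]
        exact Mfd.congr_toFun ((μ.obj α).tot.map_comp _ _) _ }
  proj :=
    { app := prodProj μ
      naturality := fun _ _ f => prodProj_naturality μ f }
  surj := prodProj_surjective μ
  subm := prodProj_isSubmersion μ
  loc := prodMap_isOpenEmb μ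
  loc_range := prodMap_range μ

end IndSys

namespace IndSys

set_option linter.unusedSectionVars false

variable {Λ : Type} [PartialOrder Λ] [Finite Λ] (μ : Λ ⥤ BunMf)
  [∀ α, (μ.obj α).PreservesProducts]

/-- The values of `G_γ` at the components of `i_α(X)` which are points are terminal. -/
noncomputable def termPt (α β : Λ) (X : Mfd) {γ : Λ} (h : ¬ α ≤ γ) :
    Limits.IsTerminal ((μ.obj β).tot.obj (((Incl.functor α).obj X).obj γ)) :=
  Limits.IsTerminal.ofIso (BunMf.mapPtIsTerminal (μ.obj β))
    ((μ.obj β).tot.mapIso (Incl.qPt α X h).symm)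

open Classical in
/-- The components of the inverse of `O_α(X)`. -/
noncomputable def invComp (α : Λ) (X : Mfd) (γ : Λ) :
    (μ.obj α).tot.obj X ⟶ (μ.obj γ).tot.obj (((Incl.functor α).obj X).obj γ) :=
  if h : α ≤ γ then trApp μ h X ≫ (μ.obj γ).tot.map (Incl.q α X h).inv
  else (termPt μ α γ X h).from _

open Classical in
theorem invComp_pos (α : Λ) (X : Mfd) {γ : Λ} (h : α ≤ γ) :
    invComp μ α X γ = trApp μ h X ≫ (μ.obj γ).tot.map (Incl.q α X h).inv :=
  dif_pos h

theorem invComp_compat (α : Λ) (X : Mfd) (z : (μ.obj α).tot.obj X) (γ δ : Λ) (h : γ ≤ δ) :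
    ((μ.obj δ).tot.map (((Incl.functor α).obj X).pr h)).toFun ((invComp μ α X δ).toFun z) =
      (trApp μ h _).toFun ((invComp μ α X γ).toFun z) := by
  by_cases hc : α ≤ γ
  · rw [invComp_pos μ α X hc, invComp_pos μ α X (hc.trans h), Mfd.comp_toFun, Mfd.comp_toFun,
      BunFun.tot_comp, BunFun.nat_apply, trApp_trans]
    have h1 : (Incl.q α X (hc.trans h)).inv ≫ ((Incl.functor α).obj X).pr h =
        (Incl.q α X hc).inv := by
      rw [Iso.inv_comp_eq, Iso.eq_comp_inv]
      exact Incl.pr_q α X h hc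
    rw [h1]
  · exact Mfd.subsingleton_of_isTerminal (termPt μ α δ X hc) _ _

/-- The diffeomorphism `O_α(X) : ∏_μ G_γ(i_α(X)) → G_α(X)`, the restriction of the projection
`∏_γ G_γ(X_γ) → G_α(X)`. -/
noncomputable def O (α : Λ) (X : Mfd) :
    prodObj μ ((Incl.functor α).obj X) ≅ (μ.obj α).tot.obj X where
  hom := comp μ ((Incl.functor α).obj X) α ≫ (μ.obj α).tot.map (Incl.q α X le_rfl).hom
  inv := prodLift μ (invComp μ α X) (invComp_compat μ α X)
  hom_inv_id := by
    ext s
    refine prod_ext μ fun γ => ?_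
    rw [Mfd.comp_toFun, comp_prodLift]
    by_cases h : α ≤ γ
    · rw [invComp_pos μ α X h, Mfd.comp_toFun, Mfd.comp_toFun, BunFun.nat_apply, ← comp_compat,
        BunFun.tot_comp, BunFun.tot_comp, ← Category.assoc, Incl.pr_q, Iso.hom_inv_id,
        CategoryTheory.Functor.map_id]
      rfl
    · exact Mfd.subsingleton_of_isTerminal (termPt μ α γ X h) _ _
  inv_hom_id := by
    ext z
    rw [Mfd.comp_toFun, Mfd.comp_toFun, comp_prodLift, invComp_pos μ α X le_rfl, Mfd.comp_toFun,
      trApp_refl, BunFun.tot_comp, Iso.inv_hom_id, CategoryTheory.Functor.map_id]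

/-- `π` is of the form `i_α(X)`. -/
def IsIncl (π : MultiFib Λ) : Prop := ∃ (α : Λ) (X : Mfd), π = (Incl.functor α).obj X

open Classical in
/-- The manifold `T^μ(π)`: it is `G_α(X)` if `π = i_α(X)`, and `∏_μ G_α(π)` if `π` is not of
this form. -/
noncomputable def Tobj (π : MultiFib Λ) : Mfd :=
  if h : IsIncl π then (μ.obj h.choose).tot.obj h.choose_spec.choose else prodObj μ π

open Classical in
/-- The diffeomorphism `I_π : T^μ(π) → ∏_μ G_α(π)`: it is `O_α(X)⁻¹` if `π = i_α(X)`, and the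
identity if `π` is not of this form. -/
noncomputable def Iobj (π : MultiFib Λ) : Tobj μ π ≅ prodObj μ π :=
  if h : IsIncl π then
    eqToIso (dif_pos h) ≪≫ (O μ h.choose h.choose_spec.choose).symm ≪≫
      eqToIso (congrArg (prodObj μ) h.choose_spec.choose_spec.symm)
  else eqToIso (dif_neg h)

/-- The bundle functor `T^μ`. -/
noncomputable def T : BunFM Λ := (prod μ).copy (Tobj μ) fun π => (Iobj μ π).symm

/-- The natural equivalence `I : T^μ ⟶ ∏_μ G_α`. -/
noncomputable def I : T μ ≅ prod μ := ((prod μ).copyIso (Tobj μ) fun π => (Iobj μ π).symm).symm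

end IndSys

namespace BunFM

set_option linter.unusedSectionVars false

variable {Λ : Type} [PartialOrder Λ] [Finite Λ] (F : BunFM Λ)

instance [F.PreservesProducts] (α : Λ) : (F.indSys.obj α).PreservesProducts :=
  inferInstanceAs (F.restrict α).PreservesProducts

variable [F.PreservesProducts]

theorem theta_compat (π : MultiFib Λ) (z : F.tot.obj π) (α β : Λ) (h : α ≤ β) :
    ((F.indSys.obj β).tot.map (π.pr h)).toFun ((F.tot.map (Incl.unit β π)).toFun z) =
      (IndSys.trApp F.indSys h (π.obj α)).toFun ((F.tot.map (Incl.unit α π)).toFun z) := by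
  change (F.tot.map ((Incl.functor β).map (π.pr h))).toFun _ =
    (F.tot.map ((Incl.idTrans h).app (π.obj α))).toFun _
  rw [F.tot_comp, F.tot_comp, Incl.unit_idTrans]

/-- The map `Θ_π : F(π) → ∏_{μ^F} G_α^F(π)` whose components are the maps `F(j_α)`. -/
noncomputable def thetaApp (π : MultiFib Λ) : F.tot.obj π ⟶ IndSys.prodObj F.indSys π :=
  IndSys.prodLift F.indSys (fun α => F.tot.map (Incl.unit α π)) (theta_compat F π)

/-- The natural transformation `Θ : F ⟶ ∏_{μ^F} G_α^F`. -/
noncomputable def Θ : F ⟶ IndSys.prod F.indSys :=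
  show BunFun.Hom F (IndSys.prod F.indSys) from
  { nat :=
      { app := thetaApp F
        naturality := fun X Y f => by
          ext z
          refine IndSys.prod_ext F.indSys fun α => ?_
          refine (F.tot_comp f (Incl.unit α Y) z).trans ?_
          rw [Incl.unit_naturality]
          exact (F.tot_comp (Incl.unit α X) _ z).symm }
    base := by
      ext X z
      refine X.point_ext fun α => ?_
      refine (IndSys.π_prodProj F.indSys X α ((thetaApp F X).toFun z)).trans ?_
      refine (F.proj_apply (Incl.unit α X) z).trans ?_
      have h := MultiFib.π_base (Incl.unit α X) α ((F.proj.app X).toFun z)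
      refine (Incl.π_q α (X.obj α) le_rfl _).symm.trans ?_
      refine (congrArg (Incl.q α (X.obj α) le_rfl).hom.toFun h).trans ?_
      refine (Mfd.congr_toFun (Incl.unit_q α X α le_rfl) _).trans ?_
      exact MultiFib.map_π X le_rfl _ }

/-- The natural transformation `κ = I⁻¹ ∘ Θ : F ⟶ T^{μ^F}`. -/
noncomputable def κ : F ⟶ IndSys.T F.indSys := F.Θ ≫ (IndSys.I F.indSys).inv

end BunFM

/-! By construction `I` is a natural equivalence, so `κ` is one as soon as `Θ` is. The localization
condition makes this a local question (`BunFun.isIso_app_of_cover`). An adapted chart is an open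
embedding of the model ξ(Λ, p) into π, so only π = ξ(Λ, p) has to be treated. In the category of
multifibered manifolds ξ(Λ, p) is the product of the objects i_{p(i)}(ℝ) (`MultiFib.stdIsLimit`),
hence F(ξ(Λ, p)) is the product of the manifolds G_{p(i)}(ℝ), where G_α = F ∘ i_α. A compatible
family (x_α) over ξ(Λ, p) carries the same data: compatibility along p(i) ≤ α forces the i-th
coordinate of x_α to be the image under μ of the i-th coordinate of x_{p(i)} (`BunFM.comp_coord`).
This gives the inverse of `Θ` in `BunFM.isIso_thetaApp_std`.

Finite products of multifibered manifolds are formed level by level (`MultiFib.piIsLimit`), and each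
G_α preserves them; therefore ∏_μ G_α, and with it T^μ, preserves products. The diffeomorphisms
O_α(X) identify the inductive system of T^μ with μ (`IndSys.indSysIso`). Uniqueness holds because
∏_μ G_α is functorial in μ (`IndSys.prodIso`): a functor F with μ^F ≅ μ is equivalent to ∏_{μ^F}, to
∏_μ and to T^μ.

For the literal equalities, the key identity is `IndSys.Θ_T`: under the identification of μ^{T^μ}
with μ, the transformation `Θ` of T^μ is `I` itself. A multifibered manifold determines its
presentation as i_α(X) except when X is a point (`Incl.functor_obj_eq`). If all G_α(pt) coincide,
this ambiguity is harmless, all the identifications T^μ(i_α(X)) = G_α(X) are identities, the systems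
are equal, and `Θ_T` says that `κ` is the identity. -/

section Manifolds

open scoped Manifold

/-! ### Diffeomorphisms, submersions and finite products of manifolds. -/

namespace Mfd

/-- A bijective smooth map with smooth local sections is a diffeomorphism. -/
theorem isIso_of_local_section {M N : Mfd} (f : M ⟶ N) (hf : Function.Injective f.toFun)
    (h : ∀ y : N, ∃ g : N → M, ContMDiffAt 𝓘(ℝ, N.E) 𝓘(ℝ, M.E) ∞ g y ∧
      ∀ᶠ z in 𝓝 y, f.toFun (g z) = z) : IsIso f := by
  have hs : Function.Surjective f.toFun := fun y => by
    obtain ⟨g, -, hg⟩ := h y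
    exact ⟨g y, hg.self_of_nhds⟩
  choose inv hinv using hs
  have smooth : ContMDiff 𝓘(ℝ, N.E) 𝓘(ℝ, M.E) ∞ inv := fun y => by
    obtain ⟨g, hg, hgf⟩ := h y
    -- Injectivity forces the local section to agree near `y` with the set-theoretic inverse, which
    -- therefore inherits its smoothness.
    refine hg.congr_of_eventuallyEq ?_
    filter_upwards [hgf] with z hz
    exact hf ((hinv z).trans hz.symm)
  exact ⟨⟨inv, smooth⟩, hom_ext fun x => hf (hinv _), hom_ext hinv⟩

/-- A smooth map with smooth sections through all points is a submersion. -/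
theorem isSubmersion_of_section {M N : Mfd} (f : M ⟶ N)
    (h : ∀ x : M, ∃ s : N ⟶ M, s ≫ f = 𝟙 N ∧ s.toFun (f.toFun x) = x) : IsSubmersion f := by
  intro x
  obtain ⟨s, hs, hx⟩ := h x
  have h1 := surjective_of_comp s f (f.toFun x) (by
    rw [hs]
    have h2 : mfderiv 𝓘(ℝ, N.E) 𝓘(ℝ, N.E) (Hom.toFun (𝟙 N)) (f.toFun x) =
      ContinuousLinearMap.id ℝ _ := mfderiv_id
    rw [h2]
    exact Function.surjective_id)
  rwa [hx] at h1

/-- Through each `x` there is a section: it puts the given values into the selected coordinates and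
keeps the coordinates of `x` elsewhere. Injectivity of `f` prevents a coordinate from being
prescribed twice. -/
theorem isSubmersion_eucMap {ι κ : Type} [Finite ι] [Finite κ] (f : κ → ι)
    (hf : Function.Injective f) : IsSubmersion (eucMap f) := by
  classical
  refine isSubmersion_of_section _ fun x => ?_
  refine ⟨eucLift fun i => if h : ∃ k, f k = i then coord h.choose else constHom _ (x i), ?_, ?_⟩
  · ext v
    funext k
    have h : ∃ k', f k' = f k := ⟨k, rfl⟩
    change Hom.toFun (N := line) (dite _ _ _) v = (v : κ → ℝ) k
    rw [dif_pos h]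
    exact congrArg v (hf h.choose_spec)
  · funext i
    change Hom.toFun (N := line) (dite _ _ _) _ = (x : ι → ℝ) i
    split_ifs with h
    · exact congrArg x h.choose_spec
    · rfl

/-- Translations of `ℝ^ι`. -/
noncomputable def eucTranslate {ι : Type} [Finite ι] (a : ι → ℝ) : euc ι ≅ euc ι where
  hom := ⟨fun v i => v i + a i, by
    let := Fintype.ofFinite ι
    exact contMDiff_pi_space.2 fun i =>
      ((contDiff_apply ℝ ℝ i).add contDiff_const).contMDiff⟩
  inv := ⟨fun v i => v i - a i, by
    let := Fintype.ofFinite ι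
    exact contMDiff_pi_space.2 fun i =>
      ((contDiff_apply ℝ ℝ i).sub contDiff_const).contMDiff⟩
  hom_inv_id := by
    ext v
    exact funext fun i => add_sub_cancel_right (v i) (a i)
  inv_hom_id := by
    ext v
    exact funext fun i => sub_add_cancel (v i) (a i)

section Pi

variable {ι : Type} [Finite ι]

/-- The product of a finite family of smooth maps. -/
noncomputable def piMap {M N : ι → Mfd} (f : ∀ i, M i ⟶ N i) : pi M ⟶ pi N :=
  piLift fun i => piProj M i ≫ f i

theorem isOpenEmb_piMap {M N : ι → Mfd} (f : ∀ i, M i ⟶ N i) (hf : ∀ i, IsOpenEmb (f i)) :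
    IsOpenEmb (piMap f) := by
  choose ho g hg hgs using hf
  have hr : range (piMap f).toFun = {y | ∀ i, y i ∈ range (f i).toFun} := by
    ext y
    constructor
    · rintro ⟨x, rfl⟩ i
      exact ⟨x i, rfl⟩
    · intro h
      choose x hx using h
      exact ⟨x, pi_ext hx⟩
  refine ⟨?_, fun y i => g i (y i), fun x => pi_ext fun i => hg i (x i), ?_⟩
  · rw [hr, Set.ofPred_forall]
    exact isOpen_iInter_of_finite fun i => (ho i).preimage (piProj N i).smooth.continuous
  · refine pi_smooth_iff _ _ fun i => (hgs i).comp (piProj N i).smooth.contMDiffOn ?_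
    rintro _ ⟨x, rfl⟩
    exact ⟨x i, rfl⟩

/-- `pi M` is the product in the category of manifolds. -/
noncomputable def piIsLimit (M : ι → Mfd) : Limits.IsLimit (Limits.Fan.mk (pi M) (piProj M)) :=
  Limits.Fan.IsLimit.mk _ (fun f => piLift f.proj) (fun _ _ => rfl) fun f g h => by
    ext x
    exact pi_ext fun i => congr_toFun (h i) x

/-- The diffeomorphism `ℝ^κ = ∏_i ℝ^(ν i)` given by a bijection of `κ` with the sum of the
`ν i`. -/
noncomputable def eucSigma {κ : Type} [Finite κ] {ν : ι → Type} [∀ i, Finite (ν i)]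
    (e : κ ≃ Σ i, ν i) : euc κ ≅ pi fun i => euc (ν i) where
  hom := piLift fun i => eucMap fun j => e.symm ⟨i, j⟩
  inv := eucLift fun k => piProj _ (e k).1 ≫ coord (e k).2
  hom_inv_id := by
    ext v
    exact funext fun k => congrArg v (e.symm_apply_apply k)
  inv_hom_id := by
    ext v
    refine pi_ext fun i => funext fun j => ?_
    -- Stated for an arbitrary `s`, because the type of `coord s.2` depends on `s.1` and the
    -- equality has to be eliminated for the pair as a whole.
    have h : ∀ s : Σ i, ν i, s = ⟨i, j⟩ →
        (coord s.2).toFun ((piProj (fun i => euc (ν i)) s.1).toFun v) = v i j := by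
      rintro _ rfl
      rfl
    exact h _ (e.apply_symm_apply _)

end Pi

end Mfd

end Manifolds

/-! ### Construction of multifibered manifolds -/

namespace MultiFib

variable {Λ : Type} [PartialOrder Λ]

theorem surjective_pr_of_surjective (X : ProjSys Λ)
    (surj : ∀ α, Function.Surjective (X.π α).toFun) {α β : Λ} (h : α ≤ β) :
    Function.Surjective (X.pr h).toFun := fun x => by
  obtain ⟨m, hm⟩ := surj α x
  exact ⟨(X.π β).toFun m, (Mfd.congr_toFun (X.π_comp h) m).trans hm⟩

/-- In a multifibered manifold, it follows from the existence of adapted charts that the surjective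
projections are submersions. -/
noncomputable def ofAdapted (X : ProjSys Λ)
    (limit : ∀ x : (∀ α, X.obj α), (∀ α β (h : α ≤ β), (X.pr h).toFun (x β) = x α) →
      ∃! m : X.tot, ∀ α, (X.π α).toFun m = x α)
    (surj : ∀ α, Function.Surjective (X.π α).toFun)
    (adapted : ∃ (n : ℕ) (p : Fin n → Λ), ∀ x, Nonempty (X.AdaptedChart p x)) : MultiFib Λ where
  toProjSys := X
  limit := limit
  surj := surj
  adapted := adapted
  surj_pr := surjective_pr_of_surjective X surj
  subm α x := by
    obtain ⟨n, p, hA⟩ := adapted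
    obtain ⟨A⟩ := hA x
    rw [← A.center]
    -- Along the chart, `π α` becomes a selection of coordinates followed by an open embedding.
    -- Surjectivity of the derivative of the composite passes to its second factor.
    refine Mfd.surjective_of_comp A.σ (X.π α) _ ?_
    rw [A.comm]
    exact (Mfd.isSubmersion_eucMap _ Subtype.val_injective).comp (A.isOpenEmb' α).isSubmersion _
  subm_pr {α β} h y := by
    -- Adapted charts are centered at points of the limit, so the point of level `β` is lifted there
    -- before a chart is chosen.
    obtain ⟨x, rfl⟩ := surj β y
    obtain ⟨n, p, hA⟩ := adapted
    obtain ⟨A⟩ := hA x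
    obtain ⟨v, hv⟩ := A.center_mem β
    rw [← hv]
    refine Mfd.surjective_of_comp (A.σ' β) (X.pr h) _ ?_
    rw [A.comm_pr]
    refine (Mfd.isSubmersion_eucMap _ fun i j hij => ?_).comp (A.isOpenEmb' α).isSubmersion _
    exact Subtype.ext (Subtype.mk.inj hij)

/-! ### The standard multifibered manifold `ξ(Λ, p)` -/

/-- The projective system `ξ(Λ, p)`. -/
noncomputable def stdSys {n : ℕ} (p : Fin n → Λ) : ProjSys Λ where
  diag :=
    { obj := fun α => Mfd.euc (ProjSys.Idx p α.unop)
      map := fun i => ProjSys.stdPr p (leOfHom i.unop)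
      map_id := fun _ => rfl
      map_comp := fun _ _ => rfl }
  tot := Mfd.euc (Fin n)
  π := ProjSys.stdProj p
  π_comp _ := rfl

/-- The multifibered manifold `ξ(Λ, p)`. -/
noncomputable def std {n : ℕ} (p : Fin n → Λ) : MultiFib Λ :=
  ofAdapted (stdSys p)
    (fun x hx => by
      -- Coordinate `i` is present exactly at the levels above `p i`. Its value is read at level `p
      -- i`, and compatibility gives it at the others.
      refine ⟨fun i => x (p i) ⟨i, le_rfl⟩, fun α => funext fun i => ?_, fun m hm => ?_⟩
      · exact (congrFun (hx (p i.1) α i.2) ⟨i.1, le_rfl⟩).symm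
      · exact funext fun i => congrFun (hm (p i)) ⟨i, le_rfl⟩)
    (fun α x => by
      classical
      exact ⟨fun i => if hi : p i ≤ α then x ⟨i, hi⟩ else 0,
        funext fun i => dif_pos (c := p i.1 ≤ α) i.2⟩)
    ⟨n, p, fun x => ⟨{
      σ := (Mfd.eucTranslate x).hom
      σ' := fun α => (Mfd.eucTranslate fun i : ProjSys.Idx p α => x i.1).hom
      isOpenEmb := Mfd.isOpenEmb_iso _
      isOpenEmb' := fun _ => Mfd.isOpenEmb_iso _
      center := funext fun i => zero_add (x i)
      comm := fun _ => rfl }⟩⟩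

/-- An adapted chart as a multifibered map. -/
noncomputable def ofChart {X : MultiFib Λ} {n : ℕ} {p : Fin n → Λ} {x : X.tot}
    (A : X.toProjSys.AdaptedChart p x) : std p ⟶ X :=
  mkHom A.σ' fun h => (A.comm_pr h).symm

theorem base_ofChart [Finite Λ] {X : MultiFib Λ} {n : ℕ} {p : Fin n → Λ} {x : X.tot}
    (A : X.toProjSys.AdaptedChart p x) : (base Λ).map (ofChart A) = A.σ := by
  ext v
  refine X.point_ext fun α => (π_base (ofChart A) α v).trans ?_
  exact (Mfd.congr_toFun (A.comm α) v).symm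

/-- This makes the localization condition of bundle functors applicable to adapted charts. -/
theorem opens_ofChart [Finite Λ] {X : MultiFib Λ} {n : ℕ} {p : Fin n → Λ} {x : X.tot}
    (A : X.toProjSys.AdaptedChart p x) : opens Λ (ofChart A) :=
  ⟨A.isOpenEmb', by rw [base_ofChart]; exact A.isOpenEmb⟩

/-- The projection of `ξ(Λ, p)` to `i_{p(i)}(ℝ)` given by the `i`-th coordinate. -/
noncomputable def stdCoord {n : ℕ} (p : Fin n → Λ) (i : Fin n) :
    std p ⟶ (Incl.functor (p i)).obj Mfd.line :=
  Incl.unit (p i) (std p) ≫ (Incl.functor (p i)).map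
    (Mfd.coord (⟨i, le_rfl⟩ : ProjSys.Idx p (p i)))

/-- `ξ(Λ, p)` is the product of the multifibered manifolds `i_{p(i)}(ℝ)`. -/
noncomputable def stdIsLimit {n : ℕ} (p : Fin n → Λ) :
    Limits.IsLimit (Limits.Fan.mk (std p) (stdCoord p)) :=
  Limits.Fan.IsLimit.mk _
    (fun f => mkHom (Y := std p) (fun α => Mfd.eucLift fun i =>
      -- Commuting with the projections leaves no choice: coordinate `i` at level `α` is the
      -- function given at level `p i`, pulled back to level `α`.
      f.pt.pr i.2 ≫ Hom.at (f.proj i.1) (p i.1) ≫ (Incl.q (p i.1) Mfd.line le_rfl).hom) fun {α β} h => by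
      ext y
      refine funext fun i => ?_
      have h1 := Mfd.congr_toFun (f.pt.pr_trans i.2 h) y
      exact congrArg (Hom.at (f.proj i.1) (p i.1) ≫
        (Incl.q (p i.1) Mfd.line le_rfl).hom).toFun h1)
    (fun f i => by
      -- By the adjunction, a map into i_{p(i)}(ℝ) is determined by its component at the single
      -- level `p i`.
      refine ((Incl.adj (p i)).homEquiv _ _).symm.injective ?_
      refine (Incl.adj_nat _ (stdCoord p i)).trans ?_
      refine (congrArg (_ ≫ ·) (Incl.adj_left (Y := std p) (Mfd.coord
        (⟨i, le_rfl⟩ : ProjSys.Idx p (p i))))).trans ?_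
      have h1 : f.pt.pr (le_refl (p i)) = 𝟙 _ := f.pt.diag.map_id _
      ext y
      exact congrArg (Hom.at (f.proj i) (p i) ≫
        (Incl.q (p i) Mfd.line le_rfl).hom).toFun (Mfd.congr_toFun h1 y))
    fun f g h => by
      refine hom_ext fun α => ?_
      ext y
      refine funext fun i => ?_
      -- The hypothesis controls coordinate `i` of `g` at level `p i` only; since `g` commutes with
      -- the projections, this controls it at level `α` as well.
      have h1 := congrArg (fun k => Hom.at k (p i.1) ≫ (Incl.q (p i.1) Mfd.line le_rfl).hom)
        (h i.1)
      have h2 := (Incl.adj_nat g (stdCoord p i.1)).symm.trans h1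
      have h3 := Incl.adj_left (Y := std p) (Mfd.coord (⟨i.1, le_rfl⟩ : ProjSys.Idx p (p i.1)))
      have h4 := Mfd.congr_toFun ((congrArg (Hom.at g (p i.1) ≫ ·) h3).symm.trans h2)
        ((f.pt.pr i.2).toFun y)
      refine Eq.trans ?_ h4
      exact (congrFun (Mfd.congr_toFun (pr_at g i.2) y) ⟨i.1, le_rfl⟩).symm

/-! ### Finite products of multifibered manifolds -/

section Pi

variable {ι : Type} [Finite ι]

/-- The product of a finite family of projective systems. -/
noncomputable def piSys (X : ι → MultiFib Λ) : ProjSys Λ where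
  diag :=
    { obj := fun α => Mfd.pi fun i => (X i).obj α.unop
      map := fun f => Mfd.piMap fun i => (X i).diag.map f
      map_id := fun α => by
        ext x
        exact Mfd.pi_ext fun i => Mfd.congr_toFun ((X i).diag.map_id α) (x i)
      map_comp := fun f g => by
        ext x
        exact Mfd.pi_ext fun i => Mfd.congr_toFun ((X i).diag.map_comp f g) (x i) }
  tot := Mfd.pi fun i => (X i).tot
  π α := Mfd.piMap fun i => (X i).π α
  π_comp h := by
    ext x
    exact Mfd.pi_ext fun i => (X i).map_π h (x i)

/-- The adapted charts of a product. -/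
theorem piSys_adapted (X : ι → MultiFib Λ) : ∃ (n : ℕ) (p : Fin n → Λ),
    ∀ x, Nonempty ((piSys X).AdaptedChart p x) := by
  choose n p hA using fun i => (X i).adapted
  let e : Fin (Nat.card (Σ i, Fin (n i))) ≃ Σ i, Fin (n i) := (Finite.equivFin _).symm
  let P : Fin (Nat.card (Σ i, Fin (n i))) → Λ := fun k => p (e k).1 (e k).2
  have hP : ∀ i j, P (e.symm ⟨i, j⟩) = p i j := fun i j =>
    congrArg (fun s : Σ i, Fin (n i) => p s.1 s.2) (e.apply_symm_apply ⟨i, j⟩)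
  -- Since `P` is `p` read through `e`, the enumeration splits at every level: the coordinates of
  -- the product present at level `α` are those of the factors present at level `α`.
  let e' : ∀ α, ProjSys.Idx P α ≃ Σ i, ProjSys.Idx (p i) α := fun α =>
    { toFun := fun k => ⟨(e k.1).1, (e k.1).2, k.2⟩
      invFun := fun s => ⟨e.symm ⟨s.1, s.2.1⟩, (hP s.1 s.2.1).trans_le s.2.2⟩
      left_inv := fun k => Subtype.ext (e.symm_apply_apply k.1)
      right_inv := fun ⟨i, j, hj⟩ => by
        have h : ∀ (s : Σ i, Fin (n i)) (hs : p s.1 s.2 ≤ α), s = ⟨i, j⟩ →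
            (⟨s.1, s.2, hs⟩ : Σ i, ProjSys.Idx (p i) α) = ⟨i, j, hj⟩ := by
          rintro _ hs rfl
          rfl
        exact h _ _ (e.apply_symm_apply _) }
  refine ⟨_, P, fun x => ?_⟩
  let A := fun i => (hA i (x i)).some
  exact ⟨{
    σ := (Mfd.eucSigma e).hom ≫ Mfd.piMap fun i => (A i).σ
    σ' := fun α => (Mfd.eucSigma (e' α)).hom ≫ Mfd.piMap fun i => (A i).σ' α
    isOpenEmb := (Mfd.isOpenEmb_iso _).comp (Mfd.isOpenEmb_piMap _ fun i => (A i).isOpenEmb)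
    isOpenEmb' := fun α =>
      (Mfd.isOpenEmb_iso _).comp (Mfd.isOpenEmb_piMap _ fun i => (A i).isOpenEmb' α)
    center := Mfd.pi_ext fun i => (A i).center
    comm := fun α => by
      ext v
      exact Mfd.pi_ext fun i => Mfd.congr_toFun ((A i).comm α) _ }⟩

/-- The product of a finite family of multifibered manifolds. -/
noncomputable def pi (X : ι → MultiFib Λ) : MultiFib Λ :=
  ofAdapted (piSys X)
    (fun x hx => by
      -- The limit of a product is computed factor by factor; uniqueness follows from `point_ext` in
      -- each factor.
      choose m hm using fun i => ((X i).limit (fun α => x α i)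
        fun α β h => congrFun (hx α β h) i).exists
      refine ⟨m, fun α => Mfd.pi_ext fun i => hm i α, fun m' hm' => Mfd.pi_ext fun i => ?_⟩
      exact (X i).point_ext fun α => (congrFun (hm' α) i).trans (hm i α).symm)
    (fun α x => by
      choose m hm using fun i => (X i).surj α (x i)
      exact ⟨m, Mfd.pi_ext hm⟩)
    (piSys_adapted X)

/-- The projections of a finite product. -/
noncomputable def piProj (X : ι → MultiFib Λ) (i : ι) : pi X ⟶ X i :=
  mkHom (X := pi X) (fun α => Mfd.piProj (fun i => (X i).obj α) i) fun _ => rfl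

/-- `pi X` is the product in the category of multifibered manifolds. -/
noncomputable def piIsLimit (X : ι → MultiFib Λ) :
    Limits.IsLimit (Limits.Fan.mk (pi X) (piProj X)) :=
  Limits.Fan.IsLimit.mk _
    (fun f => mkHom (Y := pi X) (fun α => Mfd.piLift fun i => Hom.at (f.proj i) α) fun h => by
      ext y
      exact Mfd.pi_ext fun i => Mfd.congr_toFun (pr_at (f.proj i) h) y)
    (fun _ _ => rfl) fun f g h => by
      refine hom_ext fun α => ?_
      ext y
      exact Mfd.pi_ext fun i => Mfd.congr_toFun (congrArg (Hom.at · α) (h i)) y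

end Pi

end MultiFib
-- Comparison of bundle functors: local isomorphisms and literal equality.
namespace BunFun

variable {C : Type 1} [Category.{0} C] {m : C ⥤ Mfd} {opn : MorphismProperty C}

theorem isIso_of_isIso_nat {F G : BunFun m opn} (f : F ⟶ G) [IsIso f.nat] : IsIso f :=
  ⟨⟨show Hom G F from ⟨inv f.nat, by rw [IsIso.inv_comp_eq, f.base]⟩,
    hom_ext (IsIso.hom_inv_id f.nat), hom_ext (IsIso.inv_hom_id f.nat)⟩⟩

/-- A natural equivalence of bundle functors given by diffeomorphisms of the total spaces. -/
noncomputable def isoOfComponents {F G : BunFun m opn} (e : ∀ X, F.tot.obj X ≅ G.tot.obj X)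
    (nat : ∀ {X Y : C} (f : X ⟶ Y), F.tot.map f ≫ (e Y).hom = (e X).hom ≫ G.tot.map f)
    (hproj : ∀ X, (e X).hom ≫ G.proj.app X = F.proj.app X) : F ≅ G :=
  let E := NatIso.ofComponents e nat
  have h : E.hom ≫ G.proj = F.proj := by
    ext X : 2
    exact hproj X
  { hom := show Hom F G from ⟨E.hom, h⟩
    inv := show Hom G F from ⟨E.inv, by rw [Iso.inv_comp_eq, h]⟩
    hom_inv_id := hom_ext E.hom_inv_id
    inv_hom_id := hom_ext E.inv_hom_id }

open scoped Manifold in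
/-- A natural transformation of bundle functors is an isomorphism at `X` if it is one at open
subobjects which cover `X`. -/
theorem isIso_app_of_cover {F G : BunFun m opn} (η : F ⟶ G) {X : C}
    (h : ∀ x : m.obj X, ∃ (L : C) (φ : L ⟶ X), opn φ ∧ x ∈ range (m.map φ).toFun ∧
      IsIso (η.nat.app L)) : IsIso (η.nat.app X) := by
  have hp : ∀ z, (G.proj.app X).toFun ((η.nat.app X).toFun z) = (F.proj.app X).toFun z :=
    Mfd.congr_toFun (over_app η X)
  refine Mfd.isIso_of_local_section _ (fun z w hzw => ?_) fun y => ?_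
  · obtain ⟨L, φ, hφ, hx, hL⟩ := h ((F.proj.app X).toFun z)
    have hz : z ∈ range (F.tot.map φ).toFun := by
      rw [F.loc_range φ hφ]
      exact hx
    -- As `η` covers the identity of the base, points with the same image lie over the same point of
    -- the base, hence in the same open part.
    have hw : w ∈ range (F.tot.map φ).toFun := by
      rw [F.loc_range φ hφ, mem_preimage, ← hp w, ← hzw, hp]
      exact hx
    obtain ⟨z, rfl⟩ := hz
    obtain ⟨w, rfl⟩ := hw
    rw [nat_apply, nat_apply] at hzw
    have h1 := (G.loc φ hφ).injective hzw
    have h2 := congrArg (inv (η.nat.app L)).toFun h1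
    have h3 := Mfd.congr_toFun (IsIso.hom_inv_id (η.nat.app L))
    exact congrArg _ ((h3 z).symm.trans (h2.trans (h3 w)))
  · obtain ⟨L, φ, hφ, hx, hL⟩ := h ((G.proj.app X).toFun y)
    obtain ⟨ho, r, hr, hrs⟩ := G.loc φ hφ
    have hy : range (G.tot.map φ).toFun ∈ 𝓝 y := by
      refine ho.mem_nhds ?_
      rw [G.loc_range φ hφ]
      exact hx
    -- The local section restricts to `L` through `r`, inverts `η` there, and includes the result
    -- back into the value at `X`.
    refine ⟨fun z => (F.tot.map φ).toFun ((inv (η.nat.app L)).toFun (r z)), ?_, ?_⟩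
    · exact ((F.tot.map φ).smooth _).comp y (((inv (η.nat.app L)).smooth _).comp y
        (hrs.contMDiffAt hy))
    · filter_upwards [hy] with z hz
      obtain ⟨w, rfl⟩ := hz
      rw [nat_apply, hr]
      exact congrArg _ (Mfd.congr_toFun (IsIso.inv_hom_id (η.nat.app L)) w)

theorem eqToHom_nat_app {F G : BunFun m opn} (h : F = G) (X : C) :
    (Hom.nat (eqToHom h)).app X = eqToHom (by rw [h]) := by
  subst h
  rfl

/-- Bundle functors are equal if there is a natural transformation between them which consists of
identities. -/
theorem eq_of_hom {F G : BunFun m opn} (η : F ⟶ G) (hobj : ∀ X, F.tot.obj X = G.tot.obj X)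
    (happ : ∀ X, η.nat.app X = eqToHom (hobj X)) : F = G := by
  have h : F.tot = G.tot := CategoryTheory.Functor.ext hobj fun X Y f => by
    rw [← Category.assoc, ← happ, ← η.nat.naturality, Category.assoc, happ, eqToHom_trans,
      eqToHom_refl, Category.comp_id]
  have hb := η.base
  have hη : η.nat = eqToHom h := by
    ext X : 2
    rw [happ, eqToHom_app]
  rw [hη] at hb
  clear hη happ hobj η
  revert h
  obtain ⟨t, q, _, _, _, _⟩ := F
  obtain ⟨t', q', _, _, _, _⟩ := G
  intro (h : t = t') hb
  subst h
  -- Once the total space functors coincide, covering the identity of the base means equality of the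
  -- projections, and the remaining fields are propositions.
  obtain rfl : q' = q := (Category.id_comp q').symm.trans hb
  rfl

/-- Used to replace a comparison transformation with identity components by transport along an
equality of bundle functors. -/
theorem eq_eqToHom {F G : BunFun m opn} (η : F ⟶ G) (hobj : ∀ X, F.tot.obj X = G.tot.obj X)
    (happ : ∀ X, η.nat.app X = eqToHom (hobj X)) (h : F = G) : η = eqToHom h := by
  refine hom_ext ?_
  ext X : 2
  rw [happ, eqToHom_nat_app]

theorem preservesProducts_of_iso {F G : BunFun m opn} (e : F ≅ G) (hF : F.PreservesProducts) :
    G.PreservesProducts := by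
  let E : F.tot ≅ G.tot :=
    ⟨e.hom.nat, e.inv.nat, congrArg Hom.nat e.hom_inv_id, congrArg Hom.nat e.inv_hom_id⟩
  exact ⟨fun n => Limits.preservesLimitsOfShape_of_natIso E⟩

end BunFun

/-! ### Points of the value of a product preserving functor at a product. -/

namespace BunMf

variable (G : BunMf) [G.PreservesProducts] {ι : Type} [Finite ι]

/-- For product preserving `G`, the value at a finite product is a product. -/
noncomputable def mapPiIsLimit (M : ι → Mfd) :
    Limits.IsLimit (Limits.Fan.mk (G.tot.obj (Mfd.pi M))
      fun i => G.tot.map (Mfd.piProj M i)) :=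
  Limits.isLimitFanMkObjOfIsLimit G.tot _ _ (Mfd.piIsLimit M)

/-- Points are maps from the one-point manifold, so this is the uniqueness part of the universal
property of the product. -/
theorem eq_of_piProj {M : ι → Mfd} {x y : G.tot.obj (Mfd.pi M)}
    (h : ∀ i, (G.tot.map (Mfd.piProj M i)).toFun x =
      (G.tot.map (Mfd.piProj M i)).toFun y) : x = y := by
  refine Mfd.congr_toFun (f := Mfd.constHom Mfd.pt x) (g := Mfd.constHom Mfd.pt y) ?_ PUnit.unit
  refine Limits.Fan.IsLimit.hom_ext (mapPiIsLimit G M) _ _ fun i => ?_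
  ext
  exact h i

end BunMf

/-! ### Ambiguity of the presentation i_α(X), and compatibilities of coordinates and
transformations. -/

namespace Incl

variable {Λ : Type} [PartialOrder Λ]

/-- The manifold is recovered as the total manifold. If the indices differ, some level carries `X`
in one system and the point in the other. Hence the choice made in `Tobj` is ambiguous at most over
a point. -/
theorem functor_obj_eq {α α' : Λ} {X X' : Mfd}
    (h : (functor α).obj X = (functor α').obj X') :
    X = X' ∧ (α = α' ∨ X = Mfd.pt) := by
  have hX : X = X' := congrArg (fun π : MultiFib Λ => π.tot) h
  subst hX
  refine ⟨rfl, or_iff_not_imp_left.2 fun hne => ?_⟩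
  have hobj : ∀ γ, obj α X γ = obj α' X γ := fun γ =>
    congrArg (fun π : MultiFib Λ => π.obj γ) h
  -- The two systems are compared at level `α'` if `α' ≤ α` (then `α ≰ α'`, as the indices differ),
  -- and at level `α` otherwise.
  by_cases hle : α' ≤ α
  · have hn : ¬ α ≤ α' := fun h' => hne (le_antisymm h' hle)
    have h1 := hobj α'
    rw [obj_neg hn, obj, if_pos le_rfl] at h1
    exact h1.symm
  · have h1 := hobj α
    rw [obj_neg hle, obj, if_pos le_rfl] at h1
    exact h1

end Incl

namespace MultiFib

variable {Λ : Type} [PartialOrder Λ]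

/-- Reading coordinate `i` at a level `α` above `p i` is reading it at level `p i` and then
forgetting the levels not above `α`. It rests on `Incl.unit_idTrans`, the selected coordinate at
level `α` being the pullback of that at level `p i`. -/
theorem unit_stdCoord {n : ℕ} (p : Fin n → Λ) {α : Λ} (i : ProjSys.Idx p α) :
    Incl.unit α (std p) ≫ (Incl.functor α).map (Mfd.coord i) =
      stdCoord p i.1 ≫ (Incl.idTrans i.2).app Mfd.line := by
  have h1 := Incl.unit_idTrans i.2 (std p)
  have h2 := (Incl.idTrans i.2).naturality (Mfd.coord (⟨i.1, le_rfl⟩ : ProjSys.Idx p (p i.1)))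
  have h3 := (Incl.functor α).map_comp ((std p).pr i.2)
    (Mfd.coord (⟨i.1, le_rfl⟩ : ProjSys.Idx p (p i.1)))
  have h4 := congrArg (Incl.unit α (std p) ≫ ·) h3
  refine h4.trans ?_
  refine (Category.assoc _ _ _).symm.trans ?_
  refine (congrArg (· ≫ (Incl.functor α).map
    (Mfd.coord (⟨i.1, le_rfl⟩ : ProjSys.Idx p (p i.1)))) h1).trans ?_
  refine (Category.assoc _ _ _).trans ?_
  refine (congrArg (Incl.unit (p i.1) (std p) ≫ ·) h2.symm).trans ?_
  exact (Category.assoc _ _ _).symm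

end MultiFib

namespace IndSys

theorem trans_compat {Λ : Type} [PartialOrder Λ] {μ ν : Λ ⥤ BunMf} (η : μ ⟶ ν)
    {α β : Λ} (h : α ≤ β) (X : Mfd) (x : (μ.obj α).tot.obj X) :
    ((η.app β).nat.app X).toFun ((trApp μ h X).toFun x) =
      (trApp ν h X).toFun (((η.app α).nat.app X).toFun x) := by
  have h1 := congrArg (fun k : μ.obj α ⟶ ν.obj β => (BunFun.Hom.nat k).app X)
    (η.naturality (homOfLE h))
  exact Mfd.congr_toFun h1 x

end IndSys

/-! ### The transformation `Θ` is an equivalence -/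

namespace BunFM

variable {Λ : Type} [PartialOrder Λ] [Finite Λ] (F : BunFM Λ) [F.PreservesProducts]

/-- The condition defining `prodSet`, put as an equality of morphisms so that it can be composed
with further values of `F`. -/
theorem comp_compat_hom (π : MultiFib Λ) {α β : Λ} (h : α ≤ β) :
    IndSys.comp F.indSys π β ≫ F.tot.map ((Incl.functor β).map (π.pr h)) =
      IndSys.comp F.indSys π α ≫ F.tot.map ((Incl.idTrans h).app (π.obj α)) := by
  ext s
  exact IndSys.comp_compat F.indSys π s α β h

/-- The value of `F` at `ξ(Λ, p)` is a product. -/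
noncomputable def mapStdIsLimit {n : ℕ} (p : Fin n → Λ) :
    Limits.IsLimit (Limits.Fan.mk (F.tot.obj (MultiFib.std p)) fun i =>
      F.tot.map (MultiFib.stdCoord p i)) :=
  Limits.isLimitFanMkObjOfIsLimit F.tot _ _ (MultiFib.stdIsLimit p)

/-- The inverse of `Θ` at `ξ(Λ, p)`. -/
noncomputable def thetaStdInv {n : ℕ} (p : Fin n → Λ) :
    IndSys.prodObj F.indSys (MultiFib.std p) ⟶ F.tot.obj (MultiFib.std p) :=
  -- Of a compatible family, only coordinate `i` of the component at level `p i` is used;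
  -- `comp_coord` shows that these coordinates determine the rest.
  Limits.Fan.IsLimit.lift (mapStdIsLimit F p) fun i =>
    IndSys.comp F.indSys (MultiFib.std p) (p i) ≫
      F.tot.map ((Incl.functor (p i)).map (Mfd.coord (⟨i, le_rfl⟩ : ProjSys.Idx p (p i))))

theorem thetaStdInv_stdCoord {n : ℕ} (p : Fin n → Λ) (i : Fin n) :
    thetaStdInv F p ≫ F.tot.map (MultiFib.stdCoord p i) =
      IndSys.comp F.indSys (MultiFib.std p) (p i) ≫
        F.tot.map ((Incl.functor (p i)).map (Mfd.coord (⟨i, le_rfl⟩ : ProjSys.Idx p (p i)))) :=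
  Limits.Fan.IsLimit.fac (mapStdIsLimit F p) _ i

/-- Coordinate `i` at level `α` factors through the projection to level `p i`. The compatibility
condition for `p i ≤ α` then trades the component at `α` for the one at `p i`, and naturality of the
transformation i_{p(i)} → i_α moves the coordinate function past it. -/
theorem comp_coord {n : ℕ} (p : Fin n → Λ) {α : Λ} (i : ProjSys.Idx p α) :
    IndSys.comp F.indSys (MultiFib.std p) α ≫ F.tot.map ((Incl.functor α).map (Mfd.coord i)) =
      IndSys.comp F.indSys (MultiFib.std p) (p i.1) ≫
        F.tot.map ((Incl.functor (p i.1)).map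
          (Mfd.coord (⟨i.1, le_rfl⟩ : ProjSys.Idx p (p i.1)))) ≫
        F.tot.map ((Incl.idTrans i.2).app Mfd.line) := by
  have h2 := congrArg F.tot.map
    ((Incl.idTrans i.2).naturality (Mfd.coord (⟨i.1, le_rfl⟩ : ProjSys.Idx p (p i.1))))
  rw [F.tot.map_comp, F.tot.map_comp] at h2
  refine Eq.trans ?_ (congrArg (IndSys.comp F.indSys (MultiFib.std p) (p i.1) ≫ ·) h2.symm)
  have h1 := comp_compat_hom F (MultiFib.std p) i.2
  refine Eq.trans ?_ ((congrArg (· ≫ F.tot.map ((Incl.functor α).map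
    (Mfd.coord (⟨i.1, le_rfl⟩ : ProjSys.Idx p (p i.1))))) h1).trans (Category.assoc _ _ _))
  have h3 := congrArg F.tot.map ((Incl.functor α).map_comp ((MultiFib.std p).pr i.2)
    (Mfd.coord (⟨i.1, le_rfl⟩ : ProjSys.Idx p (p i.1))))
  rw [F.tot.map_comp] at h3
  exact (congrArg (IndSys.comp F.indSys (MultiFib.std p) α ≫ ·) h3).trans
    (Category.assoc _ _ _).symm

/-- Both sides are described by one element of G_{p(i)}(ℝ) for each `i`. One composite is tested on
the product projections of F(ξ(Λ, p)); the other on every coordinate of every level, which suffices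
because each F ∘ i_α preserves products. -/
theorem isIso_thetaApp_std {n : ℕ} (p : Fin n → Λ) : IsIso (thetaApp F (MultiFib.std p)) := by
  refine ⟨⟨thetaStdInv F p, ?_, ?_⟩⟩
  · refine Limits.Fan.IsLimit.hom_ext (mapStdIsLimit F p) _ _ fun i => ?_
    refine (Category.assoc _ _ _).trans ?_
    refine (congrArg (thetaApp F (MultiFib.std p) ≫ ·) (thetaStdInv_stdCoord F p i)).trans ?_
    refine Eq.trans ?_ (Category.id_comp _).symm
    exact (F.tot.map_comp _ _).symm
  · ext s
    refine IndSys.prod_ext F.indSys fun α => ?_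
    refine BunMf.eq_of_coord (F.restrict α) fun i => ?_
    have h1 : thetaStdInv F p ≫ F.tot.map (Incl.unit α (MultiFib.std p)) ≫
        F.tot.map ((Incl.functor α).map (Mfd.coord i)) =
        IndSys.comp F.indSys (MultiFib.std p) α ≫
          F.tot.map ((Incl.functor α).map (Mfd.coord i)) := by
      refine Eq.trans ?_ (comp_coord F p i).symm
      have h2 := congrArg F.tot.map (MultiFib.unit_stdCoord p i)
      rw [F.tot.map_comp, F.tot.map_comp] at h2
      refine (congrArg (thetaStdInv F p ≫ ·) h2).trans ?_
      refine (Category.assoc _ _ _).symm.trans ?_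
      refine (congrArg (· ≫ F.tot.map ((Incl.idTrans i.2).app Mfd.line))
        (thetaStdInv_stdCoord F p i.1)).trans ?_
      exact Category.assoc _ _ _
    exact Mfd.congr_toFun h1 s

/-- Adapted charts cover every multifibered manifold by open copies of ξ(Λ, p), where `Θ` is already
known to be invertible. -/
theorem isIso_Θ : IsIso F.Θ := by
  have h : ∀ π, IsIso (F.Θ.nat.app π) := fun π => by
    refine BunFun.isIso_app_of_cover F.Θ fun x => ?_
    obtain ⟨n, p, hA⟩ := π.adapted
    obtain ⟨A⟩ := hA x
    refine ⟨MultiFib.std p, MultiFib.ofChart A, MultiFib.opens_ofChart A, ?_,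
      isIso_thetaApp_std F p⟩
    exact ⟨fun _ => (0 : ℝ), (Mfd.congr_toFun (MultiFib.base_ofChart A) _).trans A.center⟩
  have : IsIso F.Θ.nat := NatIso.isIso_of_isIso_app _
  exact BunFun.isIso_of_isIso_nat _

theorem isIso_κ : IsIso F.κ := by
  have := isIso_Θ F
  exact IsIso.comp_isIso

end BunFM

/-! ### The functor `∏_μ G_α` preserves products and depends functorially on `μ` -/

namespace IndSys

variable {Λ : Type} [PartialOrder Λ] [Finite Λ] (μ ν : Λ ⥤ BunMf)
  [∀ α, (μ.obj α).PreservesProducts] [∀ α, (ν.obj α).PreservesProducts]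

section Products

variable {ι : Type} [Finite ι] (X : ι → MultiFib Λ)

/-- The components of a map to `∏_μ G_α(π)`, where `π` is a product. -/
noncomputable def piComp {Z : Mfd} (f : ∀ i, Z ⟶ prodObj μ (X i)) (α : Λ) :
    Z ⟶ (μ.obj α).tot.obj ((MultiFib.pi X).obj α) :=
  Limits.Fan.IsLimit.lift (BunMf.mapPiIsLimit (μ.obj α) fun i => (X i).obj α) fun i =>
    f i ≫ comp μ (X i) α

theorem piComp_piProj {Z : Mfd} (f : ∀ i, Z ⟶ prodObj μ (X i)) (α : Λ) (i : ι) (z : Z) :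
    ((μ.obj α).tot.map (Mfd.piProj (fun i => (X i).obj α) i)).toFun ((piComp μ X f α).toFun z) =
      (comp μ (X i) α).toFun ((f i).toFun z) :=
  Mfd.congr_toFun (Limits.Fan.IsLimit.fac (BunMf.mapPiIsLimit (μ.obj α) fun i => (X i).obj α) _ i) z

/-- The values of the product projections separate points, and after each of them the claim is the
compatibility of the family in the corresponding factor. -/
theorem piComp_compat {Z : Mfd} (f : ∀ i, Z ⟶ prodObj μ (X i)) (z : Z) (α β : Λ) (h : α ≤ β) :
    ((μ.obj β).tot.map ((MultiFib.pi X).pr h)).toFun ((piComp μ X f β).toFun z) =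
      (trApp μ h ((MultiFib.pi X).obj α)).toFun ((piComp μ X f α).toFun z) := by
  refine BunMf.eq_of_piProj (μ.obj _) (M := fun i => (X i).obj α) fun i => ?_
  refine Eq.trans ?_ (BunFun.nat_apply (tr μ h) _ _)
  refine Eq.trans ?_ (congrArg (trApp μ h ((X i).obj α)).toFun (piComp_piProj μ X f α i z).symm)
  refine Eq.trans ?_ (comp_compat μ (X i) ((f i).toFun z) α β h)
  refine Eq.trans ?_ (congrArg ((μ.obj β).tot.map ((X i).pr h)).toFun (piComp_piProj μ X f β i z))
  refine (BunFun.tot_comp (μ.obj β) ((MultiFib.pi X).pr h)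
    (Mfd.piProj (fun i => (X i).obj α) i) _).trans ?_
  exact (BunFun.tot_comp (μ.obj β) (Mfd.piProj (fun i => (X i).obj β) i) ((X i).pr h) _).symm

/-- The value of `∏_μ G_α` at a finite product is a product. -/
noncomputable def prodPiIsLimit :
    Limits.IsLimit (Limits.Fan.mk ((prod μ).tot.obj (MultiFib.pi X)) fun i =>
      (prod μ).tot.map (MultiFib.piProj X i)) :=
  Limits.Fan.IsLimit.mk _ (fun f => prodLift μ (piComp μ X f.proj) (piComp_compat μ X f.proj))
    (fun f i => by
      ext z
      exact prod_ext μ fun α => piComp_piProj μ X f.proj α i z)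
    fun f g h => by
      ext z
      refine prod_ext μ fun α => BunMf.eq_of_piProj (μ.obj _) (M := fun i => (X i).obj α) fun i => ?_
      refine Eq.trans ?_ (piComp_piProj μ X f.proj α i z).symm
      exact congrArg (comp μ (X i) α).toFun (Mfd.congr_toFun (h i) z)

/-- Preservation may be tested on one product cone for each finite family, and the levelwise product
is the one on which the value of ∏_μ G_α can be computed. -/
theorem prod_preservesProducts : (prod μ).PreservesProducts := by
  refine ⟨fun n => ?_⟩
  have (f : Fin n → MultiFib Λ) : Limits.PreservesLimit (Discrete.functor f) (prod μ).tot :=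
    Limits.preservesLimit_of_preserves_limit_cone (MultiFib.piIsLimit f)
      ((Limits.isLimitMapConeFanMkEquiv _ _ _).symm (prodPiIsLimit μ f))
  exact Limits.preservesLimitsOfShape_of_discrete _

end Products

theorem T_preservesProducts : (T μ).PreservesProducts :=
  BunFun.preservesProducts_of_iso (I μ).symm (prod_preservesProducts μ)

section Functoriality

variable {μ ν}

/-- The map `∏_μ G_α(π) → ∏_ν G'_α(π)` given by a transformation `μ ⟶ ν` of inductive systems. -/
noncomputable def prodTransApp (η : μ ⟶ ν) (X : MultiFib Λ) : prodObj μ X ⟶ prodObj ν X :=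
  prodLift ν (fun α => comp μ X α ≫ (η.app α).nat.app (X.obj α)) fun s α β h => by
    -- The projection is moved past η_β by naturality, compatibility for `μ` is applied, and η is
    -- exchanged with the transformations of the two systems.
    refine (BunFun.nat_apply (η.app β) (X.pr h) _).symm.trans ?_
    refine (congrArg _ (comp_compat μ X s α β h)).trans ?_
    exact trans_compat η h _ _

/-- The natural transformation `∏_μ G_α ⟶ ∏_ν G'_α` given by a transformation `μ ⟶ ν` of inductive
systems. -/
noncomputable def prodTrans (η : μ ⟶ ν) : prod μ ⟶ prod ν :=
  show BunFun.Hom (prod μ) (prod ν) from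
  { nat :=
      { app := prodTransApp η
        naturality := fun X Y f => by
          ext s
          refine prod_ext ν fun α => ?_
          exact BunFun.nat_apply (η.app α) (MultiFib.Hom.at f α) ((comp μ X α).toFun s) }
    base := by
      ext X s
      refine X.point_ext fun α => ?_
      refine (π_prodProj ν X α ((prodTransApp η X).toFun s)).trans
        (Eq.trans ?_ (π_prodProj μ X α s).symm)
      exact Mfd.congr_toFun (BunFun.over_app (η.app α) (X.obj α)) _ }

theorem prodTrans_id : prodTrans (𝟙 μ) = 𝟙 (prod μ) := rfl

theorem prodTrans_comp {ρ : Λ ⥤ BunMf} [∀ α, (ρ.obj α).PreservesProducts] (η : μ ⟶ ν)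
    (θ : ν ⟶ ρ) : prodTrans (η ≫ θ) = prodTrans η ≫ prodTrans θ := rfl

/-- Isomorphic inductive systems determine naturally equivalent bundle functors. -/
noncomputable def prodIso (e : μ ≅ ν) : prod μ ≅ prod ν where
  hom := prodTrans e.hom
  inv := prodTrans e.inv
  hom_inv_id := by rw [← prodTrans_comp, e.hom_inv_id, prodTrans_id]
  inv_hom_id := by rw [← prodTrans_comp, e.inv_hom_id, prodTrans_id]

end Functoriality

/-! ### The inductive system of `T^μ` -/

/-- `O` sees only the component at level `α`, where the map i_α(f) is `f` up to the identifications
`q`. -/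
theorem O_naturality (α : Λ) {X Y : Mfd} (f : X ⟶ Y) :
    prodMap μ ((Incl.functor α).map f) ≫ (O μ α Y).hom = (O μ α X).hom ≫ (μ.obj α).tot.map f := by
  ext s
  change ((μ.obj α).tot.map (Incl.q α Y le_rfl).hom).toFun
    (((μ.obj α).tot.map _).toFun _) = ((μ.obj α).tot.map f).toFun
      (((μ.obj α).tot.map (Incl.q α X le_rfl).hom).toFun _)
  rw [BunFun.tot_comp, BunFun.tot_comp, Incl.map_q]

theorem O_proj (α : Λ) (X : Mfd) :
    (O μ α X).hom ≫ (μ.obj α).proj.app X = prodProj μ ((Incl.functor α).obj X) := by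
  ext s
  refine ((μ.obj α).proj_apply (Incl.q α X le_rfl).hom
    ((comp μ ((Incl.functor α).obj X) α).toFun s)).trans ?_
  refine (congrArg (Incl.q α X le_rfl).hom.toFun
    (π_prodProj μ ((Incl.functor α).obj X) α s).symm).trans ?_
  exact Incl.π_q α X le_rfl _

/-- The transformation i_α → i_β is the identity of `X` at level `β`, so the left side reads the
component at `β`. Over i_α(X) the projection from level `β` to level `α` is also the identity of
`X`, so compatibility makes this component the image under μ of the component at `α`. -/
theorem O_idTrans {α β : Λ} (h : α ≤ β) (X : Mfd) :
    prodMap μ ((Incl.idTrans h).app X) ≫ (O μ β X).hom = (O μ α X).hom ≫ trApp μ h X := by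
  ext s
  change ((μ.obj β).tot.map (Incl.q β X le_rfl).hom).toFun (((μ.obj β).tot.map _).toFun _) =
    (trApp μ h X).toFun (((μ.obj α).tot.map (Incl.q α X le_rfl).hom).toFun _)
  rw [BunFun.tot_comp, BunFun.nat_apply, ← comp_compat, BunFun.tot_comp, Incl.pr_q]
  rw [show _ ≫ (Incl.q β X le_rfl).hom = _ from Incl.idTrans_q h X β le_rfl]

/-- The diffeomorphism `T^μ(i_α(X)) = G_α(X)`. -/
noncomputable def restrictApp (α : Λ) (X : Mfd) :
    (T μ).tot.obj ((Incl.functor α).obj X) ≅ (μ.obj α).tot.obj X :=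
  Iobj μ ((Incl.functor α).obj X) ≪≫ O μ α X

/-- Reduces computations with the maps of T^μ to those with ∏_μ G_α, without unfolding the case
distinction in `Tobj`. -/
theorem T_map_Iobj {π π' : MultiFib Λ} (f : π ⟶ π') :
    (T μ).tot.map f ≫ (Iobj μ π').hom = (Iobj μ π).hom ≫ prodMap μ f :=
  (I μ).hom.nat.naturality f

/-- The bundle functors `T^μ ∘ i_α` and `G_α` are naturally equivalent. -/
noncomputable def restrictIso (α : Λ) : (T μ).restrict α ≅ μ.obj α :=
  BunFun.isoOfComponents (F := (T μ).restrict α) (G := μ.obj α) (restrictApp μ α)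
    (fun {X Y} f => by
      have h1 := T_map_Iobj μ ((Incl.functor α).map f)
      have h2 := O_naturality μ α f
      refine (Category.assoc _ _ _).symm.trans ?_
      refine (congrArg (· ≫ (O μ α Y).hom) h1).trans ?_
      refine (Category.assoc _ _ _).trans ?_
      refine (congrArg (_ ≫ ·) h2).trans ?_
      exact (Category.assoc _ _ _).symm)
    (fun X => by
      refine (Category.assoc _ _ _).trans ?_
      exact congrArg (_ ≫ ·) (O_proj μ α X))

/-- The inductive system of `T^μ` is isomorphic to `μ`. -/
noncomputable def indSysIso : (T μ).indSys ≅ μ :=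
  NatIso.ofComponents (F := (T μ).indSys) (restrictIso μ) fun {α β} h => by
    refine BunFun.hom_ext ?_
    ext X : 2
    have h1 := T_map_Iobj μ ((Incl.idTrans (leOfHom h)).app X)
    have h2 := O_idTrans μ (leOfHom h) X
    refine (Category.assoc _ _ _).symm.trans ?_
    refine (congrArg (· ≫ (O μ β X).hom) h1).trans ?_
    refine (Category.assoc _ _ _).trans ?_
    refine (congrArg (_ ≫ ·) h2).trans ?_
    exact (Category.assoc _ _ _).symm

/-- Under the isomorphism of the inductive system of `T^μ` with `μ`, the transformation `Θ` of `T^μ`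
is the natural equivalence `I : T^μ ⟶ ∏_μ G_α`. -/
theorem Θ_T [(T μ).PreservesProducts] :
    (T μ).Θ ≫ prodTrans (indSysIso μ).hom = (I μ).hom := by
  refine BunFun.hom_ext ?_
  ext π z
  refine prod_ext μ fun α => ?_
  -- The component of `Θ` is the value of T^μ at j_α. Through `I` it becomes the value of ∏_μ G_α at
  -- j_α, of which `O` reads the component at level `α`; there j_α is π_α^α, an identity.
  have h1 := Mfd.congr_toFun (T_map_Iobj μ (Incl.unit α π)) z
  refine (congrArg (O μ α (π.obj α)).hom.toFun h1).trans ?_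
  refine (BunFun.tot_comp (μ.obj α) (MultiFib.Hom.at (Incl.unit α π) α)
    (Incl.q α (π.obj α) le_rfl).hom ((comp μ π α).toFun ((Iobj μ π).hom.toFun z))).trans ?_
  have h2 : π.pr (le_refl α) = 𝟙 _ := π.diag.map_id _
  rw [Incl.unit_q, h2]
  exact Mfd.congr_toFun ((μ.obj α).tot.map_id _) _

/-! ### The case that all `G_α(pt)` are the same point -/

section SamePoint

/-- Two presentations of the same multifibered manifold either agree, and then the two
diffeomorphisms cancel, or concern a point. In the latter case `hpt` supplies the equality of the
values, and any two maps into the terminal object G_α(pt) coincide. -/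
theorem O_eqToHom
    (hpt : ∀ α β, (μ.obj α).tot.obj Mfd.pt = (μ.obj β).tot.obj Mfd.pt) {α α' : Λ} {X X' : Mfd}
    (h : (Incl.functor α).obj X = (Incl.functor α').obj X') :
    ∃ h' : (μ.obj α').tot.obj X' = (μ.obj α).tot.obj X,
      (O μ α' X').inv ≫ eqToHom (congrArg (prodObj μ) h.symm) ≫ (O μ α X).hom = eqToHom h' := by
  obtain ⟨rfl, rfl | rfl⟩ := Incl.functor_obj_eq h
  · exact ⟨rfl, by simp⟩
  · exact ⟨hpt α' α, (BunMf.mapPtIsTerminal (μ.obj α)).hom_ext _ _⟩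

/-- The diffeomorphism `T^μ(i_α(X)) = G_α(X)` is an identity. -/
theorem restrictApp_eqToHom
    (hpt : ∀ α β, (μ.obj α).tot.obj Mfd.pt = (μ.obj β).tot.obj Mfd.pt) (α : Λ) (X : Mfd) :
    ∃ h : (T μ).tot.obj ((Incl.functor α).obj X) = (μ.obj α).tot.obj X,
      (restrictApp μ α X).hom = eqToHom h := by
  have h : IsIncl ((Incl.functor α).obj X) := ⟨α, X, rfl⟩
  -- The presentation chosen in the definition of T^μ need not be `(α, X)`; `O_eqToHom` shows that
  -- the discrepancy is transport along an equality.
  obtain ⟨h', hO⟩ := O_eqToHom μ hpt h.choose_spec.choose_spec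
  have hT : Tobj μ ((Incl.functor α).obj X) = (μ.obj h.choose).tot.obj h.choose_spec.choose :=
    dif_pos h
  have hI : (Iobj μ ((Incl.functor α).obj X)).hom = eqToHom hT ≫
      (O μ h.choose h.choose_spec.choose).inv ≫
        eqToHom (congrArg (prodObj μ) h.choose_spec.choose_spec.symm) := by
    rw [Iobj, dif_pos h]
    rfl
  refine ⟨hT.trans h', ?_⟩
  change (Iobj μ ((Incl.functor α).obj X)).hom ≫ (O μ α X).hom = _
  rw [hI, Category.assoc, Category.assoc, hO]
  exact eqToHom_trans _ _

/-- The natural equivalence `restrictIso` has identities as components, which leaves no difference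
between the two bundle functors. -/
theorem restrict_eq
    (hpt : ∀ α β, (μ.obj α).tot.obj Mfd.pt = (μ.obj β).tot.obj Mfd.pt) (α : Λ) :
    (T μ).restrict α = μ.obj α :=
  BunFun.eq_of_hom (restrictIso μ α).hom (fun X => (restrictApp_eqToHom μ hpt α X).choose)
    fun X => (restrictApp_eqToHom μ hpt α X).choose_spec

theorem restrictIso_hom_eq
    (hpt : ∀ α β, (μ.obj α).tot.obj Mfd.pt = (μ.obj β).tot.obj Mfd.pt) (α : Λ) :
    (restrictIso μ α).hom = eqToHom (restrict_eq μ hpt α) :=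
  BunFun.eq_eqToHom _ (fun X => (restrictApp_eqToHom μ hpt α X).choose)
    (fun X => (restrictApp_eqToHom μ hpt α X).choose_spec) _

/-- Equality of the values at each `α` would not suffice: that the transformations also agree
follows from the naturality in `α` of `indSysIso`, whose components are transports along these
equalities. -/
theorem indSys_eq
    (hpt : ∀ α β, (μ.obj α).tot.obj Mfd.pt = (μ.obj β).tot.obj Mfd.pt) : (T μ).indSys = μ :=
  CategoryTheory.Functor.ext_of_iso (indSysIso μ) (restrict_eq μ hpt) (restrictIso_hom_eq μ hpt)

theorem indSysIso_hom_eq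
    (hpt : ∀ α β, (μ.obj α).tot.obj Mfd.pt = (μ.obj β).tot.obj Mfd.pt) :
    (indSysIso μ).hom = eqToHom (indSys_eq μ hpt) := by
  ext α : 2
  rw [eqToHom_app]
  exact restrictIso_hom_eq μ hpt α

end SamePoint

/-! ### Transport along equalities of inductive systems, and the conclusion. -/

variable {μ ν}

theorem T_congr (h : ν = μ) : T ν = T μ := by
  subst h
  rfl

/-- Relates the transport between the functors T to the functoriality of ∏_μ G_α in μ. After
substitution both sides are identities. -/
theorem eqToHom_T_I (h : ν = μ) (h' : T ν = T μ) :
    (I ν).inv ≫ eqToHom h' ≫ (I μ).hom = prodTrans (eqToHom h) := by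
  subst h
  rw [eqToHom_refl, eqToHom_refl, Category.id_comp, prodTrans_id]
  exact (I ν).inv_hom_id

end IndSys

theorem proposition3p2 {Λ : Type} [PartialOrder Λ] [Finite Λ] :
    -- (1) for product preserving `F`, `κ : F ⟶ T^{μ^F}` is a natural equivalence
    (∀ (F : BunFM Λ) [F.PreservesProducts], IsIso F.κ) ∧
    ∀ (μ : Λ ⥤ BunMf) [∀ α, (μ.obj α).PreservesProducts],
      -- (3) existence: `T^μ` preserves products, and its inductive system is `μ`
      (IndSys.T μ).PreservesProducts ∧
      Nonempty ((IndSys.T μ).indSys ≅ μ) ∧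
      -- (3) uniqueness, up to natural equivalence
      (∀ (F : BunFM Λ) [F.PreservesProducts],
        Nonempty (F.indSys ≅ μ) → Nonempty (F ≅ IndSys.T μ)) ∧
      -- literal equalities under the convention that all the `G_α(pt)` are the same point
      ((∀ α β, (μ.obj α).tot.obj Mfd.pt = (μ.obj β).tot.obj Mfd.pt) →
        -- (3) the inductive system of `T^μ` coincides with `μ`
        (IndSys.T μ).indSys = μ ∧
        -- (2) for `F = T^μ`, `κ` is the identity of `T^μ`
        ∃ (_ : (IndSys.T μ).PreservesProducts)
          (h : IndSys.T (IndSys.T μ).indSys = IndSys.T μ),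
          (IndSys.T μ).κ ≫ eqToHom h = 𝟙 (IndSys.T μ)) := by
  refine ⟨fun F _ => F.isIso_κ, fun μ _ => ?_⟩
  have hT := IndSys.T_preservesProducts μ
  refine ⟨hT, ⟨IndSys.indSysIso μ⟩, fun F _ ⟨e⟩ => ?_, fun hpt => ?_⟩
  · have := F.isIso_Θ
    -- The chain F ≅ ∏_{μ^F} ≅ ∏_μ ≅ T^μ; only an isomorphism of the inductive systems is needed.
    exact ⟨asIso F.Θ ≪≫ IndSys.prodIso e ≪≫ (IndSys.I μ).symm⟩
  · have h := IndSys.indSys_eq μ hpt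
    refine ⟨h, hT, IndSys.T_congr h, ?_⟩
    have h1 := IndSys.Θ_T μ
    -- With the comparison of inductive systems written as a transport, `Θ_T` says that `κ`,
    -- followed by the transport to T^μ and by `I`, is `I`; cancelling `I` gives the claim.
    rw [IndSys.indSysIso_hom_eq μ hpt, ← IndSys.eqToHom_T_I h (IndSys.T_congr h)] at h1
    rw [← cancel_mono (IndSys.I μ).hom, Category.id_comp]
    refine Eq.trans ?_ h1
    simp only [BunFM.κ, Category.assoc]
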